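/- **Theorem (local linear convergence of RBPDN).** *Setting.* Let $\mathbb R^N$ be partitioned into $n$ nonempty blocks, $x=(x_1,\dots,x_n)$ with $x_i\in\mathbb R^{N_i}$, $N_i\ge 1$. Let $F(x)=f(x)+\sum_{i=1}^n g_i(x_i)$, where each $g_i:\mathbb R^{N_i}\to\mathbb R\cup\{\infty\}$ is proper closed convex and $f:\mathbb R^N\to\mathbb R\cup\{\infty\}$ is standard self-concordant, that is: $f$ is a closed convex function with open domain $\operatorname{dom} f$, three times continuously differentiable there, and $|\psi'''(0)|\le 2\,\psi''(0)^{3/2}$ for $\psi(t)=f(x+tu)$, for all $x\in\operatorname{dom} f$, $u\in\mathbb R^N$. Assume that $\nabla^2 f$ is continuous and positive definite on $\operatorname{dom} F$ and that $F$ has a unique minimizer; let $F^*=\min F$. Let $\omega(t)=t-\ln(1+t)$. Write $\nabla_i f(x)$, $\nabla^2_{ii}f(x)$ for the subvector and submatrix of $\nabla f(x)$, $\nabla^2 f(x)$ corresponding to $x_i$, and $H(x)=\operatorname{Diag}(\nabla^2_{11}f(x),\dots,\nabla^2_{nn}f(x))$. *Method.* Let $x^0\in\operatorname{dom}F$, $\eta\in[0,1/4]$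 and $p_1,\dots,p_n>0$ with $\sum_i p_i=1$. For every $x\in \operatorname{dom}F$ and every $i$ let $d_i(x)\in\mathbb R^{N_i}$ be such that, for some $v_i\in\mathbb R^{N_i}$, $$-v_i\in\nabla_i f(x)+\nabla^2_{ii}f(x)\,d_i(x)+\partial g_i(x_i+d_i(x)),\qquad \sqrt{\langle v_i,(\nabla^2_{ii}f(x))^{-1}v_i\rangle}\le\eta\,\lambda_i(x),$$ where $\lambda_i(x)=\sqrt{\langle d_i(x),\nabla^2_{ii}f(x)\,d_i(x)\rangle}$. The random sequence $\{x^k\}$ starts at $x^0$; at iteration $k$ an index $\iota_k\in\{1,\dots,n\}$ is drawn, independently of the previous draws, with $\mathbb P(\iota_k=i)=p_i$, and $$x^{k+1}_{\iota_k}=x^k_{\iota_k}+\frac{d_{\iota_k}(x^k)}{1+\lambda_{\iota_k}(x^k)},\qquad x^{k+1}_j=x^k_j\ \ (j\ne\iota_k).$$ *Constants.* Let $\mathcal S(x^0)=\{x: F(x)\le F(x^0)\}$, let $\|\cdot\|$ be the spectral norm, and let $$\sigma_f=\min_{x\in\mathcal S(x^0)}\lambda_{\min}(\nabla^2 f(x)),\qquad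 L_f=\max_{x\in\mathcal S(x^0)}\|\nabla^2 f(x)\|,$$ $$c_1=\frac{1-\eta}{\sqrt n\,\max_{x\in\mathcal S(x^0)}\left\{(1+\eta)\|H(x)^{1/2}(\nabla^2 f(x))^{-1/2}\|+\|H(x)^{-1/2}(\nabla^2 f(x))^{1/2}\|\right\}},$$ $$p_{\min}=\min_i p_i,\qquad p_{\max}=\max_i p_i,\qquad \theta=\min_{1\le i\le n}\ \inf_{x\in\mathcal S(x^0)}\frac{p_i}{1+\lambda_i(x)},$$ $$c_2=\left|\theta\left[\left(\frac{L_f}{\sigma_f}\right)^{3/2}\frac{2(1-\eta^2)}{c_1\sqrt n}-1\right]+\left(\tfrac12+\eta\right)p_{\max}\right|.$$ *Claim.* Suppose $F(x^0)\le F^*+\omega(c_1/p_{\min})$. Then $\theta>0$, and $\theta<1$ unless $n=1$ and $x^0$ is the minimizer of $F$; moreover, for every $k\ge0$, every possible $x^k$ lies in $\operatorname{dom}F$, $F(x^k)-F^*$ is integrable, and $$\mathbb E[F(x^k)-F^*]\le\left[\frac{6c_2+p_{\min}^2(1-\theta)}{6c_2+p_{\min}^2}\right]^k\,(F(x^0)-F^*).$$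 -/

import Mathlib

open MeasureTheory ProbabilityTheory

noncomputable section

namespace RBPDN

/-! ### Extended-real-valued convex functions -/

/-- The (effective) domain of an extended-real-valued function. -/
def effDom {E : Type*} (f : E → EReal) : Set E := {x | f x < ⊤}

/-- The real-valued function which agrees with `f` wherever `f` is finite. -/
def realVal {E : Type*} (f : E → EReal) : E → ℝ := fun x => (f x).toReal

/-- Proper closed convex functions with values in `ℝ ∪ {∞}`. -/
structure ProperClosedConvex {E : Type*} [NormedAddCommGroup E] [NormedSpace ℝ E]
    (g : E → EReal) : Prop where
  ne_bot : ∀ x, g x ≠ ⊥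
  proper : (effDom g).Nonempty
  closed : LowerSemicontinuous g
  convex : ConvexOn ℝ (effDom g) (realVal g)

/-- Self-concordant functions with parameter `M`, with values in `ℝ ∪ {∞}`: closed convex functions
with open domain, three times continuously differentiable there, with
`|ψ'''(0)| ≤ M ψ''(0)^(3/2)` for every restriction `ψ(t) = f(x + tu)`, `x ∈ dom f`. -/
structure IsSelfConcordant {E : Type*} [NormedAddCommGroup E] [NormedSpace ℝ E]
    (M : ℝ) (f : E → EReal) : Prop where
  ne_bot : ∀ x, f x ≠ ⊥
  isOpen_dom : IsOpen (effDom f)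
  closed : LowerSemicontinuous f
  convex : ConvexOn ℝ (effDom f) (realVal f)
  contDiffOn : ContDiffOn ℝ 3 (realVal f) (effDom f)
  third_le : ∀ x ∈ effDom f, ∀ u : E,
    |iteratedDeriv 3 (fun t : ℝ => realVal f (x + t • u)) 0| ≤
      M * (iteratedDeriv 2 (fun t : ℝ => realVal f (x + t • u)) 0) ^ (3 / 2 : ℝ)

/-- The convex subdifferential `∂g(z)` of a proper function. -/
def subdiff {E : Type*} [NormedAddCommGroup E] [InnerProductSpace ℝ E]
    (g : E → EReal) (z : E) : Set E :=
  {s | ∀ y, g z + ((inner ℝ s (y - z) : ℝ) : EReal) ≤ g y}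

/-- `ω(t) = t - ln(1+t)`. -/
def omega (t : ℝ) : ℝ := t - Real.log (1 + t)

/-! ### Matrices -/

section Matrices

variable {ι : Type*} [Fintype ι] [DecidableEq ι]

/-- The weighted norm `‖u‖_M = √⟨u, M u⟩`. -/
def wNorm (M : Matrix ι ι ℝ) (u : EuclideanSpace ℝ ι) : ℝ :=
  Real.sqrt (u.ofLp ⬝ᵥ M.mulVec u.ofLp)

/-- The dual weighted norm `‖v‖*_M = √⟨v, M⁻¹ v⟩`. -/
def wDualNorm (M : Matrix ι ι ℝ) (v : EuclideanSpace ℝ ι) : ℝ := wNorm M⁻¹ v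

/-- The spectral norm of a matrix. -/
def specNorm (M : Matrix ι ι ℝ) : ℝ := ‖Matrix.toEuclideanCLM (n := ι) (𝕜 := ℝ) M‖

/-- The minimal eigenvalue of a symmetric matrix. -/
def lamMin (M : Matrix ι ι ℝ) : ℝ := sInf (spectrum ℝ M)

/-- The square root of a positive semidefinite matrix. -/
def matSqrt (M : Matrix ι ι ℝ) : Matrix ι ι ℝ := cfc Real.sqrt M

/-- The Hessian matrix of a real-valued function. -/
def hessian (φ : EuclideanSpace ℝ ι → ℝ) (x : EuclideanSpace ℝ ι) : Matrix ι ι ℝ :=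
  Matrix.of fun a b =>
    fderiv ℝ (fderiv ℝ φ) x (EuclideanSpace.single a 1) (EuclideanSpace.single b 1)

end Matrices

/-! ### Block structure -/

/-- The indices of the `N = ∑ N_i` coordinates, grouped into `n` blocks of sizes `N_i`. -/
abbrev Idx {n : ℕ} (N : Fin n → ℕ) : Type := Σ i : Fin n, Fin (N i)

/-- `ℝ^N` with its Euclidean norm. -/
abbrev Space {n : ℕ} (N : Fin n → ℕ) : Type := EuclideanSpace ℝ (Idx N)

/-- `ℝ^{N_i}` with its Euclidean norm. -/
abbrev Block {n : ℕ} (N : Fin n → ℕ) (i : Fin n) : Type := EuclideanSpace ℝ (Fin (N i))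

section Problem

variable {n : ℕ} {N : Fin n → ℕ}

/-- The subvector `x_i`. -/
def block (i : Fin n) (x : Space N) : Block N i := WithLp.toLp 2 fun j => x ⟨i, j⟩

/-- The objective `F(x) = f(x) + ∑ g_i(x_i)`. -/
def obj (f : Space N → EReal) (g : ∀ i, Block N i → EReal) (x : Space N) : EReal :=
  f x + ∑ i, g i (block i x)

/-- The optimal value `F^* = inf F`. -/
def optVal (f : Space N → EReal) (g : ∀ i, Block N i → EReal) : ℝ :=
  (⨅ x, obj f g x).toReal

/-- The level set `S(x⁰) = {x : F(x) ≤ F(x⁰)}`. -/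
def levelSet (f : Space N → EReal) (g : ∀ i, Block N i → EReal) (x₀ : Space N) : Set (Space N) :=
  {x | obj f g x ≤ obj f g x₀}

/-- `∇²f(x)`. -/
def hess (f : Space N → EReal) (x : Space N) : Matrix (Idx N) (Idx N) ℝ :=
  hessian (realVal f) x

/-- `∇_i f(x)`. -/
def gradBlock (f : Space N → EReal) (i : Fin n) (x : Space N) : Block N i :=
  block i (gradient (realVal f) x)

/-- `∇²_{ii} f(x)`. -/
def hessBlock (f : Space N → EReal) (i : Fin n) (x : Space N) :
    Matrix (Fin (N i)) (Fin (N i)) ℝ :=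
  (hess f x).submatrix (fun j => ⟨i, j⟩) (fun j => ⟨i, j⟩)

/-- `H(x) = Diag(∇²_{11} f(x), …, ∇²_{nn} f(x))`. -/
def blockDiagHess (f : Space N → EReal) (x : Space N) : Matrix (Idx N) (Idx N) ℝ :=
  Matrix.blockDiagonal' fun i => hessBlock f i x

/-- The standing assumptions: `f` is standard self-concordant, each `g_i` is proper closed convex,
`∇²f` is positive definite on `dom F`, and `F` has a unique minimizer. (Continuity of `∇²f` is
contained in `f` being three times continuously differentiable.) -/
structure Assumptions (f : Space N → EReal) (g : ∀ i, Block N i → EReal) : Prop where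
  selfConcordant : IsSelfConcordant 2 f
  properClosedConvex : ∀ i, ProperClosedConvex (g i)
  posDef : ∀ x ∈ effDom (obj f g), (hess f x).PosDef
  unique_min : ∃! x, ∀ y, obj f g x ≤ obj f g y

/-- `d_i(x)`, for `x ∈ dom F` and each block `i`, is an approximate solution with inexactness `η` of
`min_{d_i} f(x) + ⟨∇_i f(x), d_i⟩ + ½ ⟨d_i, ∇²_{ii} f(x) d_i⟩ + g_i(x_i + d_i)`:
for some `v_i`, `-v_i ∈ ∇_i f(x) + ∇²_{ii} f(x) d_i(x) + ∂g_i(x_i + d_i(x))` and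
`‖v_i‖*_{x_i} ≤ η ‖d_i(x)‖_{x_i}`. -/
def IsInexactDirection (f : Space N → EReal) (g : ∀ i, Block N i → EReal) (η : ℝ)
    (d : ∀ i, Space N → Block N i) : Prop :=
  ∀ x ∈ effDom (obj f g), ∀ i, ∃ v : Block N i,
    (∃ s ∈ subdiff (g i) (block i x + d i x),
      -v = gradBlock f i x + WithLp.toLp 2 ((hessBlock f i x).mulVec (d i x).ofLp) + s) ∧
    wDualNorm (hessBlock f i x) v ≤ η * wNorm (hessBlock f i x) (d i x)

/-- `λ_i(x) = ‖d_i(x)‖_{x_i}`. -/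
def lam (f : Space N → EReal) (d : ∀ i, Space N → Block N i) (i : Fin n) (x : Space N) : ℝ :=
  wNorm (hessBlock f i x) (d i x)

/-- The random sequence `X` is generated by the method from `x₀`: at iteration `k` a block `I k` is
drawn, independently of the previous draws, with probabilities `p`, and only that block is updated,
by the damped step `d_i(x)/(1+λ_i(x))`. -/
structure IsGenerated {Ω : Type*} [MeasurableSpace Ω] (μ : Measure Ω)
    (f : Space N → EReal) (d : ∀ i, Space N → Block N i) (p : Fin n → ℝ) (x₀ : Space N)
    (I : ℕ → Ω → Fin n) (X : ℕ → Ω → Space N) : Prop where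
  measurable : ∀ k, Measurable (I k)
  law : ∀ k i, μ {ω | I k ω = i} = ENNReal.ofReal (p i)
  indep : iIndepFun I μ
  init : ∀ ω, X 0 ω = x₀
  update_self : ∀ k ω, block (I k ω) (X (k + 1) ω) =
    block (I k ω) (X k ω) + (1 / (1 + lam f d (I k ω) (X k ω))) • d (I k ω) (X k ω)
  update_other : ∀ k ω j, j ≠ I k ω → block j (X (k + 1) ω) = block j (X k ω)

/-! ### The constants -/

/-- `σ_f = min_{x ∈ S(x⁰)} λ_min(∇²f(x))`. -/
def sigmaF (f : Space N → EReal) (g : ∀ i, Block N i → EReal) (x₀ : Space N) : ℝ :=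
  sInf ((fun x => lamMin (hess f x)) '' levelSet f g x₀)

/-- `L_f = max_{x ∈ S(x⁰)} ‖∇²f(x)‖`. -/
def LF (f : Space N → EReal) (g : ∀ i, Block N i → EReal) (x₀ : Space N) : ℝ :=
  sSup ((fun x => specNorm (hess f x)) '' levelSet f g x₀)

/-- `c₁ = (1-η) / (√n max_{x ∈ S(x⁰)} {(1+η)‖H^{1/2} (∇²f)^{-1/2}‖ + ‖H^{-1/2} (∇²f)^{1/2}‖})`. -/
def c1 (f : Space N → EReal) (g : ∀ i, Block N i → EReal) (η : ℝ) (x₀ : Space N) : ℝ :=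
  (1 - η) / (Real.sqrt n * sSup ((fun x =>
    (1 + η) * specNorm (matSqrt (blockDiagHess f x) * (matSqrt (hess f x))⁻¹) +
      specNorm ((matSqrt (blockDiagHess f x))⁻¹ * matSqrt (hess f x))) '' levelSet f g x₀))

/-- `p_min = min_i p_i`. -/
def pMin (p : Fin n → ℝ) : ℝ := ⨅ i, p i

/-- `p_max = max_i p_i`. -/
def pMax (p : Fin n → ℝ) : ℝ := ⨆ i, p i

/-- `θ = min_i inf_{x ∈ S(x⁰)} p_i / (1 + λ_i(x))`. -/
def theta (f : Space N → EReal) (g : ∀ i, Block N i → EReal) (d : ∀ i, Space N → Block N i)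
    (p : Fin n → ℝ) (x₀ : Space N) : ℝ :=
  ⨅ i, sInf ((fun x => p i / (1 + lam f d i x)) '' levelSet f g x₀)

/-- `c₂ = |θ[(L_f/σ_f)^{3/2} · 2(1-η²)/(c₁√n) - 1] + (1/2+η) p_max|`. -/
def c2 (f : Space N → EReal) (g : ∀ i, Block N i → EReal) (η : ℝ)
    (d : ∀ i, Space N → Block N i) (p : Fin n → ℝ) (x₀ : Space N) : ℝ :=
  |theta f g d p x₀ * ((LF f g x₀ / sigmaF f g x₀) ^ (3 / 2 : ℝ) *
      (2 * (1 - η ^ 2) / (c1 f g η x₀ * Real.sqrt n)) - 1) + (1 / 2 + η) * pMax p|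

end Problem

end RBPDN

end

open RBPDN

/-! Fix x in the level set of x⁰, write S = ∑ λ_i(x)², and let F⁺ be the value of F after one random
damped block step. Two estimates hold. (A) E[F⁺] ≤ F(x) - (p_min²/6) S (`sum_mul_decrease`). (B)
E[F⁺] - F* ≤ (1-θ)(F(x) - F*) + c₂ S (`sum_mul_contraction`). Adding 6c₂ times (A) to p_min² times
(B) cancels S and leaves the stated one-step factor (`sum_mul_gap_le`). Every step decreases F, so
the iterates stay in the level set, and the factor can be iterated by averaging each draw against
the independent history (`integral_draw_history`).

Self-concordance enters through a global lower bound with remainder ω (`lower_bound`) and an upper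
bound for damped steps, which also keeps them in the domain (`obj_damped_step_le`). The subgradient
condition enters through `direction_inequality`, which compares d_i with an arbitrary displacement
of the block.

For (A), a damped block step decreases F by at least ω(λ_i) - ηλ_i²/(1+λ_i). This is at least
(p_min/6) λ_i² once p_min λ_i ≤ 1. That bound is what closeness to F* provides (`pMin_mul_lam_le`):
a damped step along all d_i together shows that F(x) - F* ≥ ω(τ) with τ proportional to √S, so F(x⁰)
- F* ≤ ω(c₁/p_min) bounds √S.

For (B), comparing d_i with the displacement to the minimizer z bounds the predicted change of F by
-(F(x) - F*), up to a multiple of S and a cross term in λ_i and the local norms of (z-x)_i. The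
cross term is O(S) because the distance to z is controlled by √S (`sum_lam_mul_wNorm_sub_le`), by
uniform strong convexity and smoothness on the compact convex level set. -/

namespace RBPDN

/-! ### Cauchy-Schwarz inequalities for the local norms and their duals. -/

section WeightedNorms

variable {ι : Type*} [Fintype ι] {M : Matrix ι ι ℝ}

lemma wNorm_nonneg (M : Matrix ι ι ℝ) (u : EuclideanSpace ℝ ι) : 0 ≤ wNorm M u :=
  Real.sqrt_nonneg _

lemma quadForm_nonneg (hM : M.PosSemidef) (u : ι → ℝ) : 0 ≤ u ⬝ᵥ M.mulVec u := by
  simpa using hM.dotProduct_mulVec_nonneg u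

lemma wNorm_sq (hM : M.PosSemidef) (u : EuclideanSpace ℝ ι) :
    wNorm M u ^ 2 = u.ofLp ⬝ᵥ M.mulVec u.ofLp :=
  Real.sq_sqrt (quadForm_nonneg hM _)

lemma wNorm_pos (hM : M.PosDef) {u : EuclideanSpace ℝ ι} (hu : u ≠ 0) : 0 < wNorm M u := by
  refine Real.sqrt_pos.2 ?_
  have : u.ofLp ≠ 0 := fun h => hu (by ext i; simp [h])
  simpa using hM.dotProduct_mulVec_pos this

lemma wNorm_smul (M : Matrix ι ι ℝ) (t : ℝ) (u : EuclideanSpace ℝ ι) :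
    wNorm M (t • u) = |t| * wNorm M u := by
  unfold wNorm
  rw [← Real.sqrt_sq_eq_abs, ← Real.sqrt_mul (sq_nonneg t)]
  congr 1
  simp only [WithLp.ofLp_smul, Matrix.mulVec_smul, dotProduct_smul, smul_dotProduct, smul_eq_mul]
  ring

lemma dotProduct_mulVec_comm (hM : M.IsHermitian) (u w : ι → ℝ) :
    u ⬝ᵥ M.mulVec w = w ⬝ᵥ M.mulVec u := by
  have hT : M.transpose = M := Matrix.isHermitian_iff_isSymm.1 hM
  rw [Matrix.dotProduct_mulVec, ← Matrix.mulVec_transpose, hT, dotProduct_comm]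

/-- The quadratic form of u + tw is a nonnegative quadratic polynomial in t, so its discriminant is
at most zero. -/
lemma abs_dotProduct_mulVec_le (hM : M.PosSemidef) (u w : EuclideanSpace ℝ ι) :
    |u.ofLp ⬝ᵥ M.mulVec w.ofLp| ≤ wNorm M u * wNorm M w := by
  refine abs_le_of_sq_le_sq ?_ (mul_nonneg (wNorm_nonneg _ _) (wNorm_nonneg _ _))
  rw [mul_pow, wNorm_sq hM, wNorm_sq hM]
  set b := u.ofLp ⬝ᵥ M.mulVec w.ofLp with hb
  have key : ∀ t : ℝ, 0 ≤ (w.ofLp ⬝ᵥ M.mulVec w.ofLp) * (t * t) + (2 * b) * t +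
      u.ofLp ⬝ᵥ M.mulVec u.ofLp := by
    intro t
    have h := quadForm_nonneg hM (u.ofLp + t • w.ofLp)
    simp only [Matrix.mulVec_add, Matrix.mulVec_smul, dotProduct_add, add_dotProduct,
      smul_dotProduct, dotProduct_smul, smul_eq_mul] at h
    rw [dotProduct_mulVec_comm hM.1 w.ofLp u.ofLp, ← hb] at h
    linarith
  have := discrim_le_zero key
  unfold discrim at this
  nlinarith

/-- Cauchy-Schwarz in the M-inner product for u and M⁻¹v: the M-norm of M⁻¹v is the dual norm of v.
-/
lemma abs_dotProduct_le_wDualNorm [DecidableEq ι] (hM : M.PosDef) (v u : EuclideanSpace ℝ ι) :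
    |v.ofLp ⬝ᵥ u.ofLp| ≤ wDualNorm M v * wNorm M u := by
  have hdet : IsUnit M.det := (Matrix.isUnit_iff_isUnit_det _).1 hM.isUnit
  have hv : M.mulVec (M⁻¹.mulVec v.ofLp) = v.ofLp := by
    rw [Matrix.mulVec_mulVec, Matrix.mul_nonsing_inv _ hdet, Matrix.one_mulVec]
  have h := abs_dotProduct_mulVec_le hM.posSemidef u (WithLp.toLp 2 (M⁻¹.mulVec v.ofLp))
  have h2 : wNorm M (WithLp.toLp 2 (M⁻¹.mulVec v.ofLp)) = wDualNorm M v := by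
    unfold wDualNorm wNorm
    rw [WithLp.ofLp_toLp, hv, dotProduct_comm]
  rw [h2, WithLp.ofLp_toLp, hv, dotProduct_comm, mul_comm] at h
  exact h

lemma inner_eq_dotProduct (u w : EuclideanSpace ℝ ι) : inner ℝ u w = u.ofLp ⬝ᵥ w.ofLp := by
  rw [EuclideanSpace.inner_eq_star_dotProduct, dotProduct_comm]; simp

lemma norm_sq_eq_dotProduct (u : EuclideanSpace ℝ ι) : ‖u‖ ^ 2 = u.ofLp ⬝ᵥ u.ofLp := by
  rw [← real_inner_self_eq_norm_sq, inner_eq_dotProduct]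

end WeightedNorms

/-! ### Spectral norm, matrix square root and smallest eigenvalue. -/

section MatrixNorms

variable {ι : Type*} [Fintype ι] [DecidableEq ι] {M : Matrix ι ι ℝ}

lemma specNorm_nonneg (M : Matrix ι ι ℝ) : 0 ≤ specNorm M := norm_nonneg _

lemma norm_mulVec_le (M : Matrix ι ι ℝ) (u : EuclideanSpace ℝ ι) :
    ‖WithLp.toLp 2 (M.mulVec u.ofLp)‖ ≤ specNorm M * ‖u‖ := by
  have := (Matrix.toEuclideanCLM (n := ι) (𝕜 := ℝ) M).le_opNorm u
  rwa [show Matrix.toEuclideanCLM (n := ι) (𝕜 := ℝ) M u = WithLp.toLp 2 (M.mulVec u.ofLp) from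
    Matrix.toEuclideanCLM_toLp M u.ofLp] at this

lemma specNorm_transpose (M : Matrix ι ι ℝ) : specNorm M.transpose = specNorm M := by
  have h : star M = M.transpose := by
    rw [Matrix.star_eq_conjTranspose, Matrix.conjTranspose_eq_transpose_of_trivial]
  unfold specNorm
  rw [← h, map_star, ContinuousLinearMap.star_eq_adjoint, LinearIsometryEquiv.norm_map]

lemma abs_dotProduct_mulVec_le_specNorm (M : Matrix ι ι ℝ) (u w : EuclideanSpace ℝ ι) :
    |u.ofLp ⬝ᵥ M.mulVec w.ofLp| ≤ specNorm M * ‖u‖ * ‖w‖ := by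
  have h := abs_real_inner_le_norm u (WithLp.toLp 2 (M.mulVec w.ofLp))
  rw [inner_eq_dotProduct] at h
  refine h.trans ?_
  nlinarith [mul_le_mul_of_nonneg_left (norm_mulVec_le M w) (norm_nonneg u)]

lemma matSqrt_isHermitian (M : Matrix ι ι ℝ) : (matSqrt M).IsHermitian :=
  cfc_predicate Real.sqrt M

lemma matSqrt_mul_self (hM : M.PosSemidef) : matSqrt M * matSqrt M = M := by
  have hs := (Matrix.posSemidef_iff_isHermitian_and_spectrum_nonneg.1 hM).2
  have hsa : IsSelfAdjoint M := hM.1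
  unfold matSqrt
  rw [← cfc_mul Real.sqrt Real.sqrt M]
  conv_rhs => rw [← cfc_id ℝ M hsa]
  exact cfc_congr fun x hx => Real.mul_self_sqrt (hs hx)

lemma matSqrt_isUnit_det (hM : M.PosDef) : IsUnit (matSqrt M).det := by
  have hdet : IsUnit M.det := (Matrix.isUnit_iff_isUnit_det _).1 hM.isUnit
  rw [← matSqrt_mul_self hM.posSemidef, Matrix.det_mul] at hdet
  exact isUnit_of_mul_isUnit_left hdet

lemma wNorm_eq_norm (hM : M.PosSemidef) (u : EuclideanSpace ℝ ι) :
    wNorm M u = ‖WithLp.toLp 2 ((matSqrt M).mulVec u.ofLp)‖ := by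
  have hT : (matSqrt M).transpose = matSqrt M :=
    Matrix.isHermitian_iff_isSymm.1 (matSqrt_isHermitian M)
  rw [← Real.sqrt_sq (norm_nonneg _), norm_sq_eq_dotProduct]
  unfold wNorm
  congr 1
  conv_lhs => rw [← matSqrt_mul_self hM, ← Matrix.mulVec_mulVec, Matrix.dotProduct_mulVec,
    ← Matrix.mulVec_transpose, hT]

/-- `‖u‖_P ≤ ‖P^{1/2} Q^{-1/2}‖ ‖u‖_Q`. -/
lemma wNorm_le_specNorm_mul {P Q : Matrix ι ι ℝ} (hP : P.PosSemidef) (hQ : Q.PosDef)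
    (u : EuclideanSpace ℝ ι) :
    wNorm P u ≤ specNorm (matSqrt P * (matSqrt Q)⁻¹) * wNorm Q u := by
  rw [wNorm_eq_norm hP, wNorm_eq_norm hQ.posSemidef]
  refine le_trans (le_of_eq ?_) (norm_mulVec_le _ _)
  rw [WithLp.ofLp_toLp, Matrix.mulVec_mulVec, Matrix.mul_assoc,
    Matrix.nonsing_inv_mul _ (matSqrt_isUnit_det hQ), Matrix.mul_one]

/-- `‖u‖_P ≤ ‖Q^{-1/2} P^{1/2}‖ ‖u‖_Q`. -/
lemma wNorm_le_specNorm_mul' {P Q : Matrix ι ι ℝ} (hP : P.PosSemidef) (hQ : Q.PosDef)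
    (u : EuclideanSpace ℝ ι) :
    wNorm P u ≤ specNorm ((matSqrt Q)⁻¹ * matSqrt P) * wNorm Q u := by
  have hT : ∀ M : Matrix ι ι ℝ, (matSqrt M).transpose = matSqrt M := fun M =>
    Matrix.isHermitian_iff_isSymm.1 (matSqrt_isHermitian M)
  have := wNorm_le_specNorm_mul hP hQ u
  rwa [← specNorm_transpose, Matrix.transpose_mul, Matrix.transpose_nonsing_inv, hT, hT] at this

/-- Subtracting c from the matrix translates the spectrum by -c. This turns the spectral definition
of `lamMin` into a Rayleigh quotient bound, in both directions. -/
lemma sub_algebraMap_posSemidef_iff (hM : M.IsHermitian) (c : ℝ) :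
    (M - algebraMap ℝ _ c).PosSemidef ↔ ∀ x ∈ spectrum ℝ M, c ≤ x := by
  have hc : (M - algebraMap ℝ (Matrix ι ι ℝ) c).IsHermitian := by
    refine hM.sub ?_
    rw [Matrix.algebraMap_eq_diagonal]
    exact Matrix.isHermitian_diagonal _
  rw [Matrix.posSemidef_iff_isHermitian_and_spectrum_nonneg]
  rw [sub_eq_add_neg, ← map_neg, add_comm, ← spectrum.vadd_eq]
  constructor
  · rintro ⟨-, h⟩ x hx
    have := h (Set.vadd_mem_vadd_set (a := -c) hx)
    simp only [vadd_eq_add, Set.mem_ofPred_eq] at this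
    linarith
  · intro h
    refine ⟨by rwa [sub_eq_add_neg, ← map_neg, add_comm] at hc, ?_⟩
    rintro _ ⟨x, hx, rfl⟩
    have := h x hx
    simp only [vadd_eq_add, Set.mem_ofPred_eq]
    linarith

lemma sub_algebraMap_quadForm (c : ℝ) (u : EuclideanSpace ℝ ι) :
    u.ofLp ⬝ᵥ (M - algebraMap ℝ _ c).mulVec u.ofLp = u.ofLp ⬝ᵥ M.mulVec u.ofLp - c * ‖u‖ ^ 2 := by
  rw [Matrix.sub_mulVec, dotProduct_sub, norm_sq_eq_dotProduct, Algebra.algebraMap_eq_smul_one,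
    Matrix.smul_mulVec, Matrix.one_mulVec, dotProduct_smul, smul_eq_mul]

lemma lamMin_mul_norm_sq_le (hM : M.IsHermitian) (u : EuclideanSpace ℝ ι) :
    lamMin M * ‖u‖ ^ 2 ≤ u.ofLp ⬝ᵥ M.mulVec u.ofLp := by
  have hbdd : BddBelow (spectrum ℝ M) := M.finite_real_spectrum.bddBelow
  have h := quadForm_nonneg ((sub_algebraMap_posSemidef_iff hM (lamMin M)).2
    fun x hx => csInf_le hbdd hx) u.ofLp
  rw [sub_algebraMap_quadForm] at h
  linarith

lemma le_lamMin [Nonempty ι] (hM : M.IsHermitian) {c : ℝ}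
    (h : ∀ u : EuclideanSpace ℝ ι, c * ‖u‖ ^ 2 ≤ u.ofLp ⬝ᵥ M.mulVec u.ofLp) : c ≤ lamMin M := by
  have hne : (spectrum ℝ M).Nonempty := by
    rw [hM.spectrum_real_eq_range_eigenvalues]
    exact Set.range_nonempty _
  refine le_csInf hne ((sub_algebraMap_posSemidef_iff hM c).1 ?_)
  have hc : (M - algebraMap ℝ (Matrix ι ι ℝ) c).IsHermitian := by
    refine hM.sub ?_
    rw [Matrix.algebraMap_eq_diagonal]
    exact Matrix.isHermitian_diagonal _
  refine Matrix.PosSemidef.of_dotProduct_mulVec_nonneg hc fun u => ?_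
  have := sub_algebraMap_quadForm (M := M) c (WithLp.toLp 2 u)
  have h2 := h (WithLp.toLp 2 u)
  simp only [star_trivial] at *
  linarith

end MatrixNorms

/-! ### Self-concordant functions of one variable. -/

section OneDim

/-- A function with nonnegative second derivative lies above its zero tangent. -/
lemma nonneg_of_second_deriv_nonneg {u u₁ u₂ : ℝ → ℝ} {T : ℝ}
    (h₀ : ∀ t ∈ Set.Icc 0 T, HasDerivAt u (u₁ t) t)
    (h₁ : ∀ t ∈ Set.Icc 0 T, HasDerivAt u₁ (u₂ t) t)
    (h₂ : ∀ t ∈ Set.Icc 0 T, 0 ≤ u₂ t) (hu : u 0 = 0) (hu₁ : u₁ 0 = 0) :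
    ∀ t ∈ Set.Icc 0 T, 0 ≤ u t := by
  have mono : ∀ {v v₁ : ℝ → ℝ}, (∀ t ∈ Set.Icc 0 T, HasDerivAt v (v₁ t) t) →
      (∀ t ∈ Set.Icc 0 T, 0 ≤ v₁ t) → v 0 = 0 → ∀ t ∈ Set.Icc 0 T, 0 ≤ v t := by
    intro v v₁ hv hv₁ hv0 t ht
    have hmono : MonotoneOn v (Set.Icc 0 T) := by
      refine monotoneOn_of_deriv_nonneg (convex_Icc _ _)
        (fun s hs => (hv s hs).continuousAt.continuousWithinAt)
        (fun s hs => (hv s (interior_subset hs)).differentiableAt.differentiableWithinAt)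
        fun s hs => ?_
      rw [(hv s (interior_subset hs)).deriv]
      exact hv₁ s (interior_subset hs)
    have := hmono ⟨le_rfl, ht.1.trans ht.2⟩ ht ht.1
    rwa [hv0] at this
  exact mono h₀ (mono h₁ h₂ hu₁) hu

/-- Along a segment, `φ''^{-1/2}` is nonexpansive for a self-concordant `φ`. -/
lemma abs_rsqrt_sub_le {φ₂ φ₃ : ℝ → ℝ} {T : ℝ}
    (h : ∀ t ∈ Set.Icc 0 T, HasDerivAt φ₂ (φ₃ t) t) (hpos : ∀ t ∈ Set.Icc 0 T, 0 < φ₂ t)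
    (hsc : ∀ t ∈ Set.Icc 0 T, |φ₃ t| ≤ 2 * φ₂ t ^ (3 / 2 : ℝ)) {t : ℝ} (ht : t ∈ Set.Icc 0 T) :
    |(Real.sqrt (φ₂ t))⁻¹ - (Real.sqrt (φ₂ 0))⁻¹| ≤ t := by
  have hd : ∀ s ∈ Set.Icc 0 T, HasDerivWithinAt (fun s => (Real.sqrt (φ₂ s))⁻¹)
      (-(φ₃ s / (2 * Real.sqrt (φ₂ s))) / Real.sqrt (φ₂ s) ^ 2) (Set.Icc 0 T) s := fun s hs =>
    (((h s hs).sqrt (hpos s hs).ne').inv (Real.sqrt_pos.2 (hpos s hs)).ne').hasDerivWithinAt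
  -- The derivative of φ₂^(-1/2) is -φ₃/(2φ₂^(3/2)), so the constant 2 of standard self-concordance
  -- gives exactly the Lipschitz constant 1.
  have hb : ∀ s ∈ Set.Icc 0 T,
      ‖-(φ₃ s / (2 * Real.sqrt (φ₂ s))) / Real.sqrt (φ₂ s) ^ 2‖ ≤ 1 := by
    intro s hs
    have hq := Real.sqrt_pos.2 (hpos s hs)
    have h32 : φ₂ s ^ (3 / 2 : ℝ) = Real.sqrt (φ₂ s) ^ 3 := by
      rw [Real.sqrt_eq_rpow, ← Real.rpow_natCast, ← Real.rpow_mul (hpos s hs).le]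
      norm_num
    have h3 := hsc s hs
    rw [h32] at h3
    rw [Real.norm_eq_abs, abs_div, abs_neg, abs_div,
      abs_of_pos (by positivity : 0 < 2 * Real.sqrt (φ₂ s)),
      abs_of_pos (by positivity : 0 < Real.sqrt (φ₂ s) ^ 2), div_div, div_le_one (by positivity)]
    calc |φ₃ s| ≤ 2 * Real.sqrt (φ₂ s) ^ 3 := h3
      _ = 2 * Real.sqrt (φ₂ s) * Real.sqrt (φ₂ s) ^ 2 := by ring
  have := (convex_Icc (0 : ℝ) T).norm_image_sub_le_of_norm_hasDerivWithin_le hd hb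
    ⟨le_rfl, ht.1.trans ht.2⟩ ht
  simpa [abs_of_nonneg ht.1] using this

variable {φ φ₁ φ₂ φ₃ : ℝ → ℝ} {T : ℝ}
  (h₀ : ∀ t ∈ Set.Icc 0 T, HasDerivAt φ (φ₁ t) t)
  (h₁ : ∀ t ∈ Set.Icc 0 T, HasDerivAt φ₁ (φ₂ t) t)
  (h₂ : ∀ t ∈ Set.Icc 0 T, HasDerivAt φ₂ (φ₃ t) t)
  (hpos : ∀ t ∈ Set.Icc 0 T, 0 < φ₂ t)
  (hsc : ∀ t ∈ Set.Icc 0 T, |φ₃ t| ≤ 2 * φ₂ t ^ (3 / 2 : ℝ))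
include h₀ h₁ h₂ hpos hsc

/-- With r = √φ₂(0), the Lipschitz bound on φ₂^(-1/2) gives √φ₂(s) ≥ r/(1+sr). Integrating the
square twice produces ω(tr). -/
lemma selfConcordant_lower {t : ℝ} (ht : t ∈ Set.Icc 0 T) :
    φ 0 + t * φ₁ 0 + omega (t * Real.sqrt (φ₂ 0)) ≤ φ t := by
  have h0T : (0 : ℝ) ∈ Set.Icc 0 T := ⟨le_rfl, ht.1.trans ht.2⟩
  set r := Real.sqrt (φ₂ 0) with hr
  have hrpos : 0 < r := Real.sqrt_pos.2 (hpos 0 h0T)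
  have hden : ∀ s ∈ Set.Icc 0 T, 0 < 1 + s * r := fun s hs => by
    have := mul_nonneg hs.1 hrpos.le; linarith
  have hlin : ∀ s : ℝ, HasDerivAt (fun s => 1 + s * r) r s := fun s => by
    simpa using ((hasDerivAt_id s).mul_const r).const_add 1
  have hu : ∀ s ∈ Set.Icc 0 T, HasDerivAt (fun s => φ s - φ 0 - s * φ₁ 0 - omega (s * r))
      (φ₁ s - φ₁ 0 - (r - r / (1 + s * r))) s := by
    intro s hs
    have hlog := (hlin s).log (hden s hs).ne'
    have hom : HasDerivAt (fun s => omega (s * r)) (r - r / (1 + s * r)) s :=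
      (by simpa using (hasDerivAt_id s).mul_const r : HasDerivAt (fun s => s * r) r s).sub hlog
    have hl : HasDerivAt (fun s => s * φ₁ 0) (φ₁ 0) s := by
      simpa using (hasDerivAt_id s).mul_const (φ₁ 0)
    exact (((h₀ s hs).sub_const _).sub hl).sub hom
  have hu₁ : ∀ s ∈ Set.Icc 0 T, HasDerivAt (fun s => φ₁ s - φ₁ 0 - (r - r / (1 + s * r)))
      (φ₂ s - r ^ 2 / (1 + s * r) ^ 2) s := by
    intro s hs
    have hdiv := (hasDerivAt_const s r).div (hlin s) (hden s hs).ne'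
    have := ((h₁ s hs).sub_const (φ₁ 0)).sub (hdiv.const_sub r)
    exact this.congr_deriv (by ring)
  have hu₂ : ∀ s ∈ Set.Icc 0 T, 0 ≤ φ₂ s - r ^ 2 / (1 + s * r) ^ 2 := by
    intro s hs
    have hq := Real.sqrt_pos.2 (hpos s hs)
    have hb := (abs_le.1 (abs_rsqrt_sub_le h₂ hpos hsc hs)).2
    have h3 : (Real.sqrt (φ₂ s))⁻¹ ≤ (1 + s * r) / r := by
      have : (1 + s * r) / r = r⁻¹ + s := by field_simp
      rw [this]; linarith
    have h4 : r / (1 + s * r) ≤ Real.sqrt (φ₂ s) := by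
      rw [inv_le_comm₀ hq (div_pos (hden s hs) hrpos), inv_div] at h3
      exact h3
    have h5 := pow_le_pow_left₀ (div_pos hrpos (hden s hs)).le h4 2
    rw [Real.sq_sqrt (hpos s hs).le, div_pow] at h5
    linarith
  have := nonneg_of_second_deriv_nonneg hu hu₁ hu₂ (by simp [omega]) (by simp) t ht
  linarith

/-- The opposite half of the same Lipschitz bound gives √φ₂(s) ≤ r/(1-sr). It is useful only while
sr < 1, which explains the condition on T. -/
lemma selfConcordant_upper {t : ℝ} (ht : t ∈ Set.Icc 0 T) (hT : T * Real.sqrt (φ₂ 0) < 1) :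
    φ t ≤ φ 0 + t * φ₁ 0 - t * Real.sqrt (φ₂ 0) - Real.log (1 - t * Real.sqrt (φ₂ 0)) := by
  have h0T : (0 : ℝ) ∈ Set.Icc 0 T := ⟨le_rfl, ht.1.trans ht.2⟩
  set r := Real.sqrt (φ₂ 0) with hr
  have hrpos : 0 < r := Real.sqrt_pos.2 (hpos 0 h0T)
  have hden : ∀ s ∈ Set.Icc 0 T, 0 < 1 - s * r := fun s hs => by
    have := mul_le_mul_of_nonneg_right hs.2 hrpos.le; linarith
  have hlin : ∀ s : ℝ, HasDerivAt (fun s => 1 - s * r) (-r) s := fun s => by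
    simpa using ((hasDerivAt_id s).mul_const r).const_sub 1
  have hu : ∀ s ∈ Set.Icc 0 T,
      HasDerivAt (fun s => φ 0 + s * φ₁ 0 - s * r - Real.log (1 - s * r) - φ s)
      (φ₁ 0 - r - (-r) / (1 - s * r) - φ₁ s) s := by
    intro s hs
    have hlog := (hlin s).log (hden s hs).ne'
    have hl : ∀ c : ℝ, HasDerivAt (fun s => s * c) c s := fun c => by
      simpa using (hasDerivAt_id s).mul_const c
    exact ((((hl (φ₁ 0)).const_add _).sub (hl r)).sub hlog).sub (h₀ s hs)
  have hu₁ : ∀ s ∈ Set.Icc 0 T, HasDerivAt (fun s => φ₁ 0 - r - (-r) / (1 - s * r) - φ₁ s)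
      (r ^ 2 / (1 - s * r) ^ 2 - φ₂ s) s := by
    intro s hs
    have hdiv := (hasDerivAt_const s (-r)).div (hlin s) (hden s hs).ne'
    have := (hdiv.const_sub (φ₁ 0 - r)).sub (h₁ s hs)
    exact this.congr_deriv (by ring)
  have hu₂ : ∀ s ∈ Set.Icc 0 T, 0 ≤ r ^ 2 / (1 - s * r) ^ 2 - φ₂ s := by
    intro s hs
    have hq := Real.sqrt_pos.2 (hpos s hs)
    have hb := (abs_le.1 (abs_rsqrt_sub_le h₂ hpos hsc hs)).1
    have h3 : (1 - s * r) / r ≤ (Real.sqrt (φ₂ s))⁻¹ := by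
      have : (1 - s * r) / r = r⁻¹ - s := by field_simp
      rw [this]; linarith
    have h4 : Real.sqrt (φ₂ s) ≤ r / (1 - s * r) := by
      rw [le_inv_comm₀ (div_pos (hden s hs) hrpos) hq, inv_div] at h3
      exact h3
    have h5 := pow_le_pow_left₀ hq.le h4 2
    rw [Real.sq_sqrt (hpos s hs).le, div_pow] at h5
    linarith
  have := nonneg_of_second_deriv_nonneg hu hu₁ hu₂ (by simp) (by simp) t ht
  linarith

end OneDim

/-! ### Scalar estimates for ω and the logarithm. -/

section Omega

lemma omega_strictMonoOn : StrictMonoOn omega (Set.Ici 0) := by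
  intro a ha b hb hab
  have ha' : (0 : ℝ) ≤ a := ha
  have hb' : (0 : ℝ) ≤ b := hb
  have h1 : (1 + b) / (1 + a) ≠ 1 := by
    rw [Ne, div_eq_one_iff_eq (by linarith)]; linarith
  have h2 := Real.log_lt_sub_one_of_pos (by positivity : 0 < (1 + b) / (1 + a)) h1
  rw [Real.log_div (by positivity) (by positivity)] at h2
  have h3 : (1 + b) / (1 + a) - 1 ≤ b - a := by
    rw [div_sub_one (by positivity), div_le_iff₀ (by positivity)]
    nlinarith
  unfold omega
  linarith

/-- A Padé bound for the logarithm. -/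
lemma log_one_add_le {l : ℝ} (hl : 0 ≤ l) :
    Real.log (1 + l) ≤ l * (6 + l) / (6 + 4 * l) := by
  have hd : ∀ t ∈ Set.Ici (0 : ℝ), HasDerivAt
      (fun t : ℝ => t * (6 + t) / (6 + 4 * t) - Real.log (1 + t))
      ((((6 + t) + t * 1) * (6 + 4 * t) - t * (6 + t) * 4) / (6 + 4 * t) ^ 2 - 1 / (1 + t)) t := by
    intro t ht
    have ht' : (0 : ℝ) ≤ t := ht
    have a1 : HasDerivAt (fun t : ℝ => t * (6 + t)) (1 * (6 + t) + t * 1) t :=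
      (hasDerivAt_id t).mul ((hasDerivAt_id t).const_add 6)
    have a2 : HasDerivAt (fun t : ℝ => 6 + 4 * t) 4 t := by
      simpa using ((hasDerivAt_id t).const_mul 4).const_add 6
    have a3 : HasDerivAt (fun t : ℝ => Real.log (1 + t)) (1 / (1 + t)) t :=
      ((hasDerivAt_id t).const_add 1).log (by simp; positivity)
    have := (a1.div a2 (by positivity)).sub a3
    rwa [one_mul] at this
  have hmono : MonotoneOn (fun t : ℝ => t * (6 + t) / (6 + 4 * t) - Real.log (1 + t))
      (Set.Ici 0) := by
    refine monotoneOn_of_deriv_nonneg (convex_Ici _)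
      (fun s hs => (hd s hs).continuousAt.continuousWithinAt)
      (fun s hs => (hd s (interior_subset hs)).differentiableAt.differentiableWithinAt)
      fun s hs => ?_
    have hs' : (0 : ℝ) ≤ s := interior_subset hs
    rw [(hd s (interior_subset hs)).deriv, sub_nonneg, div_le_div_iff₀ (by positivity)
      (by positivity)]
    -- Once denominators are cleared, the two sides differ by exactly 4s³.
    nlinarith [pow_nonneg hs' 3, pow_nonneg hs' 2]
  have := hmono (Set.mem_Ici.2 le_rfl) (Set.mem_Ici.2 hl) hl
  simp at this
  linarith

/-- Replaces ω by a rational function, so that the later scalar inequalities become polynomial. -/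
lemma omega_ge {l : ℝ} (hl : 0 ≤ l) : 3 * l ^ 2 / (6 + 4 * l) ≤ omega l := by
  have h := log_one_add_le hl
  have : l - l * (6 + l) / (6 + 4 * l) = 3 * l ^ 2 / (6 + 4 * l) := by
    field_simp; ring
  unfold omega
  linarith

end Omega

/-! ### Block decomposition of vectors, quadratic forms and the Hessian. -/

section Blocks

variable {n : ℕ} {N : Fin n → ℕ}

@[simp] lemma block_add (i : Fin n) (x y : Space N) : block i (x + y) = block i x + block i y := rfl

@[simp] lemma block_smul (i : Fin n) (t : ℝ) (x : Space N) : block i (t • x) = t • block i x := rfl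

lemma block_ext {x y : Space N} (h : ∀ i, block i x = block i y) : x = y := by
  ext ⟨i, j⟩
  exact congrArg (fun z : Block N i => z j) (h i)

lemma continuous_block (i : Fin n) : Continuous (block i : Space N → Block N i) := by
  unfold block
  fun_prop

/-- The vector whose blocks are the given ones. -/
def assemble (d : ∀ i, Block N i) : Space N := WithLp.toLp 2 fun q => d q.1 q.2

@[simp] lemma block_assemble (d : ∀ i, Block N i) (i : Fin n) : block i (assemble d) = d i := rfl

/-- The inclusion of the `i`-th block. -/
def embed (i : Fin n) (u : Block N i) : Space N :=
  assemble (Pi.single (M := fun j => Block N j) i u)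

@[simp] lemma block_embed_same (i : Fin n) (u : Block N i) : block i (embed i u) = u := by
  simp [embed]

lemma block_embed_of_ne {i j : Fin n} (h : j ≠ i) (u : Block N i) : block j (embed i u) = 0 := by
  simp [embed, h]

lemma dotProduct_eq_sum_block (x y : Space N) :
    x.ofLp ⬝ᵥ y.ofLp = ∑ i, (block i x).ofLp ⬝ᵥ (block i y).ofLp := by
  simp only [dotProduct, Fintype.sum_sigma]
  rfl

lemma norm_sq_eq_sum_block (x : Space N) : ‖x‖ ^ 2 = ∑ i, ‖block i x‖ ^ 2 := by
  rw [norm_sq_eq_dotProduct, dotProduct_eq_sum_block]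
  simp only [norm_sq_eq_dotProduct]

lemma dotProduct_embed (x : Space N) (i : Fin n) (u : Block N i) :
    x.ofLp ⬝ᵥ (embed i u).ofLp = (block i x).ofLp ⬝ᵥ u.ofLp := by
  rw [dotProduct_eq_sum_block, Finset.sum_eq_single i]
  · simp
  · intro j _ hj
    simp [block_embed_of_ne hj]
  · simp

lemma norm_embed (i : Fin n) (u : Block N i) : ‖embed i u‖ = ‖u‖ := by
  have : ‖embed i u‖ ^ 2 = ‖u‖ ^ 2 := by
    rw [norm_sq_eq_dotProduct, norm_sq_eq_dotProduct, dotProduct_embed, block_embed_same]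
  exact (pow_left_inj₀ (norm_nonneg _) (norm_nonneg _) two_ne_zero).1 this

lemma block_mulVec_embed (M : Matrix (Idx N) (Idx N) ℝ) (i : Fin n) (u : Block N i) :
    (block i (WithLp.toLp 2 (M.mulVec (embed i u).ofLp))).ofLp =
      (M.submatrix (fun j => ⟨i, j⟩) (fun j => ⟨i, j⟩)).mulVec u.ofLp := by
  ext j
  change (fun q => M ⟨i, j⟩ q) ⬝ᵥ (embed i u).ofLp = _
  have := dotProduct_embed (WithLp.toLp 2 (fun q => M ⟨i, j⟩ q)) i u
  rw [WithLp.ofLp_toLp] at this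
  rw [this]
  rfl

lemma quadForm_embed (M : Matrix (Idx N) (Idx N) ℝ) (i : Fin n) (u : Block N i) :
    (embed i u).ofLp ⬝ᵥ M.mulVec (embed i u).ofLp =
      u.ofLp ⬝ᵥ (M.submatrix (fun j => ⟨i, j⟩) (fun j => ⟨i, j⟩)).mulVec u.ofLp := by
  have := dotProduct_embed (WithLp.toLp 2 (M.mulVec (embed i u).ofLp)) i u
  rw [WithLp.ofLp_toLp] at this
  rw [dotProduct_comm, this, block_mulVec_embed, dotProduct_comm]

lemma wNorm_embed (f : Space N → EReal) (x : Space N) (i : Fin n) (u : Block N i) :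
    wNorm (hess f x) (embed i u) = wNorm (hessBlock f i x) u := by
  unfold wNorm hessBlock
  rw [quadForm_embed]

lemma blockDiagHess_quadForm (f : Space N → EReal) (x u w : Space N) :
    u.ofLp ⬝ᵥ (blockDiagHess f x).mulVec w.ofLp =
      ∑ i, (block i u).ofLp ⬝ᵥ (hessBlock f i x).mulVec (block i w).ofLp := by
  have h : WithLp.toLp 2 ((blockDiagHess f x).mulVec w.ofLp) =
      assemble fun i => WithLp.toLp 2 ((hessBlock f i x).mulVec (block i w).ofLp) := by
    ext ⟨i, j⟩
    simp only [assemble, Matrix.mulVec, dotProduct, Fintype.sum_sigma, blockDiagHess]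
    rw [Finset.sum_eq_single i]
    · simp [Matrix.blockDiagonal'_apply_eq, block]
    · intro k _ hk
      exact Finset.sum_eq_zero fun l _ => by
        rw [Matrix.blockDiagonal'_apply_ne _ _ _ hk.symm, zero_mul]
    · simp
  have h' := congrArg WithLp.ofLp h
  rw [WithLp.ofLp_toLp] at h'
  rw [h', dotProduct_eq_sum_block]
  rfl

lemma posDef_hessBlock {f : Space N → EReal} {x : Space N} (h : (hess f x).PosDef) (i : Fin n) :
    (hessBlock f i x).PosDef :=
  h.submatrix fun a b hab => by simpa using hab

lemma posDef_blockDiagHess {f : Space N → EReal} {x : Space N} (h : (hess f x).PosDef) :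
    (blockDiagHess f x).PosDef := by
  have hH : (blockDiagHess f x).IsHermitian := by
    unfold Matrix.IsHermitian blockDiagHess
    rw [Matrix.blockDiagonal'_conjTranspose]
    congr 1
    funext i
    exact (posDef_hessBlock h i).1
  refine Matrix.PosDef.of_dotProduct_mulVec_pos hH fun {u} hu => ?_
  have hs := blockDiagHess_quadForm f x (WithLp.toLp 2 u) (WithLp.toLp 2 u)
  rw [WithLp.ofLp_toLp] at hs
  rw [star_trivial, hs]
  obtain ⟨⟨i, j⟩, hij⟩ := Function.ne_iff.1 hu
  refine Finset.sum_pos' (fun k _ => quadForm_nonneg (posDef_hessBlock h k).posSemidef _)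
    ⟨i, Finset.mem_univ i, ?_⟩
  have hne : (block i (WithLp.toLp 2 u : Space N)).ofLp ≠ 0 := fun h0 => hij (congrFun h0 j)
  simpa using (posDef_hessBlock h i).dotProduct_mulVec_pos hne

lemma wNorm_blockDiagHess_sq {f : Space N → EReal} {x : Space N} (h : (hess f x).PosDef)
    (u : Space N) :
    wNorm (blockDiagHess f x) u ^ 2 = ∑ i, wNorm (hessBlock f i x) (block i u) ^ 2 := by
  rw [wNorm_sq (posDef_blockDiagHess h).posSemidef, blockDiagHess_quadForm]
  exact Finset.sum_congr rfl fun i _ => (wNorm_sq (posDef_hessBlock h i).posSemidef _).symm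

end Blocks

/-! ### Passing from extended-real values to real values, and convexity of the domains. -/

section Domains

variable {n : ℕ} {N : Fin n → ℕ} {f : Space N → EReal} {g : ∀ i, Block N i → EReal}

/-- The domain of `∑ g_i`. -/
def sepDom (g : ∀ i, Block N i → EReal) : Set (Space N) := {x | ∀ i, block i x ∈ effDom (g i)}

/-- The values of `∑ g_i` on its domain. -/
def sepVal (g : ∀ i, Block N i → EReal) (x : Space N) : ℝ := ∑ i, realVal (g i) (block i x)

lemma coe_realVal {E : Type*} {φ : E → EReal} (hφ : ∀ x, φ x ≠ ⊥) {x : E} (hx : x ∈ effDom φ) :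
    ((realVal φ x : ℝ) : EReal) = φ x :=
  EReal.coe_toReal (ne_of_lt hx) (hφ x)

lemma sum_ne_bot {ι : Type*} (s : Finset ι) {a : ι → EReal} (h : ∀ i, a i ≠ ⊥) :
    ∑ i ∈ s, a i ≠ ⊥ := by
  classical
  induction s using Finset.induction_on with
  | empty => simp
  | insert i s hi ih => rw [Finset.sum_insert hi, Ne, EReal.add_eq_bot_iff]; tauto

lemma sum_eq_top {ι : Type*} {s : Finset ι} {a : ι → EReal} (h : ∀ i, a i ≠ ⊥) {i : ι}
    (hi : i ∈ s) (ht : a i = ⊤) : ∑ i ∈ s, a i = ⊤ := by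
  classical
  rw [← Finset.add_sum_erase s a hi, ht]
  exact EReal.top_add_of_ne_bot (sum_ne_bot _ h)

lemma coe_sepVal (hg : ∀ i, ProperClosedConvex (g i)) {x : Space N} (hx : x ∈ sepDom g) :
    ((sepVal g x : ℝ) : EReal) = ∑ i, g i (block i x) := by
  unfold sepVal
  have hc := map_sum (⟨⟨Real.toEReal, EReal.coe_zero⟩, EReal.coe_add⟩ : ℝ →+ EReal)
    (fun i => realVal (g i) (block i x)) Finset.univ
  refine hc.trans ?_
  exact Finset.sum_congr rfl fun i _ => coe_realVal (hg i).ne_bot (hx i)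

lemma mem_effDom_obj (h : Assumptions f g) {x : Space N} :
    x ∈ effDom (obj f g) ↔ x ∈ effDom f ∧ x ∈ sepDom g := by
  have hgb : ∀ i, g i (block i x) ≠ ⊥ := fun i => (h.properClosedConvex i).ne_bot _
  constructor
  · intro hx
    have hx' : f x + ∑ i, g i (block i x) < ⊤ := hx
    refine ⟨?_, fun i => ?_⟩
    · change f x < ⊤
      refine lt_top_iff_ne_top.2 fun ht => ?_
      rw [ht, EReal.top_add_of_ne_bot (sum_ne_bot _ hgb)] at hx'
      exact lt_irrefl _ hx'
    · change g i (block i x) < ⊤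
      refine lt_top_iff_ne_top.2 fun ht => ?_
      rw [sum_eq_top hgb (Finset.mem_univ i) ht,
        EReal.add_top_of_ne_bot (h.selfConcordant.ne_bot x)] at hx'
      exact lt_irrefl _ hx'
  · rintro ⟨h1, h2⟩
    change f x + ∑ i, g i (block i x) < ⊤
    rw [← coe_sepVal h.properClosedConvex h2, ← coe_realVal h.selfConcordant.ne_bot h1]
    exact EReal.coe_lt_top _

lemma coe_add_sepVal (h : Assumptions f g) {x : Space N} (hx : x ∈ effDom (obj f g)) :
    ((realVal f x + sepVal g x : ℝ) : EReal) = obj f g x := by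
  obtain ⟨h1, h2⟩ := (mem_effDom_obj h).1 hx
  rw [EReal.coe_add, coe_sepVal h.properClosedConvex h2, coe_realVal h.selfConcordant.ne_bot h1]
  rfl

lemma obj_ne_bot (h : Assumptions f g) (x : Space N) : obj f g x ≠ ⊥ := by
  unfold obj
  rw [Ne, EReal.add_eq_bot_iff]
  have := h.selfConcordant.ne_bot x
  have := sum_ne_bot Finset.univ fun i => (h.properClosedConvex i).ne_bot (block i x)
  tauto

lemma realVal_obj (h : Assumptions f g) {x : Space N} (hx : x ∈ effDom (obj f g)) :
    realVal (obj f g) x = realVal f x + sepVal g x := by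
  unfold realVal at *
  rw [← coe_add_sepVal h hx, EReal.toReal_coe]
  rfl

lemma convex_sepDom (hg : ∀ i, ProperClosedConvex (g i)) : Convex ℝ (sepDom g) := by
  intro x hx y hy a b ha hb hab i
  exact (hg i).convex.1 (hx i) (hy i) ha hb hab

lemma sepVal_add_smul_le (hg : ∀ i, ProperClosedConvex (g i)) {x u : Space N} {t : ℝ}
    (hx : x ∈ sepDom g) (hu : x + u ∈ sepDom g) (ht : t ∈ Set.Icc (0 : ℝ) 1) :
    sepVal g (x + t • u) ≤ sepVal g x + t * (sepVal g (x + u) - sepVal g x) := by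
  have : sepVal g x + t * (sepVal g (x + u) - sepVal g x) =
      (1 - t) * sepVal g x + t * sepVal g (x + u) := by ring
  rw [this]
  unfold sepVal
  rw [Finset.mul_sum, Finset.mul_sum, ← Finset.sum_add_distrib]
  refine Finset.sum_le_sum fun i _ => ?_
  have := (hg i).convex.2 (hx i) (hu i) (sub_nonneg.2 ht.2) ht.1 (by ring)
  simp only [smul_eq_mul] at this
  convert this using 2
  simp only [block_add, block_smul, smul_add, sub_smul, one_smul]
  abel

lemma add_smul_mem_of_convex {E : Type*} [AddCommGroup E] [Module ℝ E] {s : Set E}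
    (hs : Convex ℝ s) {x u : E} (hx : x ∈ s) (hu : x + u ∈ s) {t : ℝ}
    (ht : t ∈ Set.Icc (0 : ℝ) 1) : x + t • u ∈ s := by
  simpa using hs.add_smul_sub_mem hx hu ht

lemma convex_effDom_obj (h : Assumptions f g) : Convex ℝ (effDom (obj f g)) := by
  have : effDom (obj f g) = effDom f ∩ sepDom g := Set.ext fun x => mem_effDom_obj h
  rw [this]
  exact h.selfConcordant.convex.1.inter (convex_sepDom h.properClosedConvex)

end Domains

/-! ### Derivatives of f along lines. -/

section Derivatives

variable {n : ℕ} {N : Fin n → ℕ} {f : Space N → EReal} {g : ∀ i, Block N i → EReal}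

lemma hasDerivAt_line {E : Type*} [NormedAddCommGroup E] [NormedSpace ℝ E] {φ : E → ℝ} {x u : E}
    {t : ℝ} (h : DifferentiableAt ℝ φ (x + t • u)) :
    HasDerivAt (fun t : ℝ => φ (x + t • u)) (fderiv ℝ φ (x + t • u) u) t := by
  have hl : HasDerivAt (fun t : ℝ => x + t • u) u t := by
    simpa using ((hasDerivAt_id t).smul_const u).const_add x
  exact h.hasFDerivAt.comp_hasDerivAt t hl

lemma bilin_eq_dotProduct {ι : Type*} [Fintype ι] [DecidableEq ι]
    (B : EuclideanSpace ℝ ι →L[ℝ] EuclideanSpace ℝ ι →L[ℝ] ℝ) (u w : EuclideanSpace ℝ ι) :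
    B u w = u.ofLp ⬝ᵥ (Matrix.of fun a b =>
      B (EuclideanSpace.single a 1) (EuclideanSpace.single b 1)).mulVec w.ofLp := by
  have he : ∀ v : EuclideanSpace ℝ ι, v = ∑ a, v a • EuclideanSpace.single a (1 : ℝ) := by
    intro v
    ext b
    simp [Finset.sum_apply, Pi.single_apply]
  conv_lhs => rw [he u, he w]
  simp only [map_sum, map_smul, sum_apply, smul_apply,
    smul_eq_mul, dotProduct, Matrix.mulVec, Matrix.of_apply, Finset.mul_sum]
  rw [Finset.sum_comm]
  refine Finset.sum_congr rfl fun a _ => Finset.sum_congr rfl fun b _ => ?_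
  ring

lemma hess_quadForm (f : Space N → EReal) (x u w : Space N) :
    fderiv ℝ (fderiv ℝ (realVal f)) x u w = u.ofLp ⬝ᵥ (hess f x).mulVec w.ofLp :=
  bilin_eq_dotProduct _ u w

lemma gradient_dotProduct (f : Space N → EReal) (x u : Space N) :
    (gradient (realVal f) x).ofLp ⬝ᵥ u.ofLp = fderiv ℝ (realVal f) x u := by
  rw [← inner_eq_dotProduct]
  exact InnerProductSpace.toDual_symm_apply

lemma IsSelfConcordant.contDiffAt {E : Type*} [NormedAddCommGroup E] [NormedSpace ℝ E] {M : ℝ}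
    {f : E → EReal} (h : IsSelfConcordant M f) {x : E} (hx : x ∈ effDom f) :
    ContDiffAt ℝ 3 (realVal f) x :=
  h.contDiffOn.contDiffAt (h.isOpen_dom.mem_nhds hx)

lemma IsSelfConcordant.differentiableAt {E : Type*} [NormedAddCommGroup E] [NormedSpace ℝ E]
    {M : ℝ} {f : E → EReal} (h : IsSelfConcordant M f) {x : E} (hx : x ∈ effDom f) :
    DifferentiableAt ℝ (realVal f) x :=
  (h.contDiffAt hx).differentiableAt (by norm_num)

lemma IsSelfConcordant.contDiffAt_fderiv {E : Type*} [NormedAddCommGroup E] [NormedSpace ℝ E]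
    {M : ℝ} {f : E → EReal} (h : IsSelfConcordant M f) {x : E} (hx : x ∈ effDom f) :
    ContDiffAt ℝ 2 (fderiv ℝ (realVal f)) x :=
  (h.contDiffAt hx).fderiv_right (by norm_num)

lemma IsSelfConcordant.contDiffAt_fderiv_fderiv {E : Type*} [NormedAddCommGroup E]
    [NormedSpace ℝ E] {M : ℝ} {f : E → EReal} (h : IsSelfConcordant M f) {x : E}
    (hx : x ∈ effDom f) : ContDiffAt ℝ 1 (fderiv ℝ (fderiv ℝ (realVal f))) x :=
  (h.contDiffAt_fderiv hx).fderiv_right (by norm_num)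

lemma hasDerivAt_line_fderiv {f : Space N → EReal} (h : IsSelfConcordant 2 f) {x u : Space N}
    {t : ℝ} (ht : x + t • u ∈ effDom f) (w : Space N) :
    HasDerivAt (fun t : ℝ => fderiv ℝ (realVal f) (x + t • u) w)
      (u.ofLp ⬝ᵥ (hess f (x + t • u)).mulVec w.ofLp) t := by
  have hd : DifferentiableAt ℝ (fderiv ℝ (realVal f)) (x + t • u) :=
    (h.contDiffAt_fderiv ht).differentiableAt (by norm_num)
  have h2 := hasDerivAt_line (φ := fun z => fderiv ℝ (realVal f) z w)
    (hd.clm_apply (differentiableAt_const w))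
  have h3 : fderiv ℝ (fun z => fderiv ℝ (realVal f) z w) (x + t • u) u =
      fderiv ℝ (fderiv ℝ (realVal f)) (x + t • u) u w := by
    rw [fderiv_clm_apply hd (differentiableAt_const w)]
    simp
  rwa [h3, hess_quadForm] at h2

/-- The definition of self-concordance only speaks of parameter 0, so the line is re-based at y = x
+ tu. As dom f is open, near 0 the iterated derivatives of the restriction agree with the Fréchet
derivatives of f. -/
lemma line_third_deriv {f : Space N → EReal} (h : IsSelfConcordant 2 f) {x u : Space N}
    {t : ℝ} (ht : x + t • u ∈ effDom f) :
    ∃ c, HasDerivAt (fun t : ℝ => u.ofLp ⬝ᵥ (hess f (x + t • u)).mulVec u.ofLp) c t ∧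
      |c| ≤ 2 * (u.ofLp ⬝ᵥ (hess f (x + t • u)).mulVec u.ofLp) ^ (3 / 2 : ℝ) := by
  set F₂ : Space N → ℝ := fun z => fderiv ℝ (fderiv ℝ (realVal f)) z u u with hF₂
  set y := x + t • u with hy
  have hd : DifferentiableAt ℝ F₂ y :=
    (((h.contDiffAt_fderiv_fderiv ht).differentiableAt (by norm_num)).clm_apply
      (differentiableAt_const u)).clm_apply (differentiableAt_const u)
  simp only [← hess_quadForm]
  refine ⟨fderiv ℝ F₂ y u, hasDerivAt_line hd, ?_⟩
  have hy0 : y + (0 : ℝ) • u = y := by simp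
  have hev : ∀ᶠ s : ℝ in nhds 0, y + s • u ∈ effDom f := by
    have hc : Continuous fun s : ℝ => y + s • u := by fun_prop
    refine hc.continuousAt.eventually_mem (h.isOpen_dom.mem_nhds ?_)
    rwa [hy0]
  have h1 : ∀ᶠ s : ℝ in nhds 0, deriv (fun s : ℝ => realVal f (y + s • u)) s =
      fderiv ℝ (realVal f) (y + s • u) u :=
    hev.mono fun s hs => (hasDerivAt_line (h.differentiableAt hs)).deriv
  have h2 : ∀ᶠ s : ℝ in nhds 0, deriv (deriv (fun s : ℝ => realVal f (y + s • u))) s =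
      F₂ (y + s • u) := by
    filter_upwards [hev, h1.eventually_nhds] with s hs hs1
    have : deriv (fun s : ℝ => realVal f (y + s • u)) =ᶠ[nhds s]
      fun s => fderiv ℝ (realVal f) (y + s • u) u := hs1
    rw [this.deriv_eq, (hasDerivAt_line_fderiv h hs u).deriv, hF₂]
    exact (hess_quadForm f _ _ _).symm
  have h3 : deriv (deriv (deriv (fun s : ℝ => realVal f (y + s • u)))) 0 = fderiv ℝ F₂ y u := by
    have : deriv (deriv (fun s : ℝ => realVal f (y + s • u))) =ᶠ[nhds 0]
      fun s => F₂ (y + s • u) := h2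
    rw [this.deriv_eq, (hasDerivAt_line (φ := F₂) (by rwa [hy0])).deriv, hy0]
  have := h.third_le y ht u
  simp only [iteratedDeriv_succ, iteratedDeriv_zero] at this
  rw [h3, h2.self_of_nhds, hy0] at this
  exact this

end Derivatives

/-! ### Self-concordant bounds for f and for damped steps. -/

section SelfConcordance

variable {n : ℕ} {N : Fin n → ℕ} {f : Space N → EReal} {g : ∀ i, Block N i → EReal}

lemma line_self_concordant (h : Assumptions f g) {x u : Space N} (hu : u ≠ 0) {T : ℝ}
    (hT : ∀ t ∈ Set.Icc 0 T, x + t • u ∈ effDom (obj f g)) :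
    ∃ φ₃ : ℝ → ℝ,
      (∀ t ∈ Set.Icc 0 T, HasDerivAt (fun t : ℝ => realVal f (x + t • u))
        (fderiv ℝ (realVal f) (x + t • u) u) t) ∧
      (∀ t ∈ Set.Icc 0 T, HasDerivAt (fun t : ℝ => fderiv ℝ (realVal f) (x + t • u) u)
        (u.ofLp ⬝ᵥ (hess f (x + t • u)).mulVec u.ofLp) t) ∧
      (∀ t ∈ Set.Icc 0 T, HasDerivAt
        (fun t : ℝ => u.ofLp ⬝ᵥ (hess f (x + t • u)).mulVec u.ofLp) (φ₃ t) t) ∧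
      (∀ t ∈ Set.Icc 0 T, 0 < u.ofLp ⬝ᵥ (hess f (x + t • u)).mulVec u.ofLp) ∧
      (∀ t ∈ Set.Icc 0 T,
        |φ₃ t| ≤ 2 * (u.ofLp ⬝ᵥ (hess f (x + t • u)).mulVec u.ofLp) ^ (3 / 2 : ℝ)) := by
  have hf : ∀ t ∈ Set.Icc 0 T, x + t • u ∈ effDom f := fun t ht =>
    ((mem_effDom_obj h).1 (hT t ht)).1
  -- Membership in the interval is a premise inside the existential, so that `choose` yields a third
  -- derivative defined on all of ℝ.
  have hex : ∀ t : ℝ, ∃ c : ℝ, t ∈ Set.Icc 0 T →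
      HasDerivAt (fun t : ℝ => u.ofLp ⬝ᵥ (hess f (x + t • u)).mulVec u.ofLp) c t ∧
      |c| ≤ 2 * (u.ofLp ⬝ᵥ (hess f (x + t • u)).mulVec u.ofLp) ^ (3 / 2 : ℝ) := by
    intro t
    by_cases ht : t ∈ Set.Icc 0 T
    · obtain ⟨c, hc⟩ := line_third_deriv h.selfConcordant (hf t ht)
      exact ⟨c, fun _ => hc⟩
    · exact ⟨0, fun h => absurd h ht⟩
  choose φ₃ hφ₃ using hex
  have hu' : u.ofLp ≠ 0 := fun h0 => hu (by ext i; simp [h0])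
  exact ⟨φ₃, fun t ht => hasDerivAt_line (h.selfConcordant.differentiableAt (hf t ht)),
    fun t ht => hasDerivAt_line_fderiv h.selfConcordant (hf t ht) u,
    fun t ht => (hφ₃ t ht).1,
    fun t ht => by simpa using (h.posDef _ (hT t ht)).dotProduct_mulVec_pos hu',
    fun t ht => (hφ₃ t ht).2⟩

lemma omega_zero : omega 0 = 0 := by simp [omega]

lemma omega_nonneg {t : ℝ} (ht : 0 ≤ t) : 0 ≤ omega t := by
  rw [← omega_zero]
  exact omega_strictMonoOn.monotoneOn (Set.mem_Ici.2 le_rfl) ht ht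

/-- The global lower bound for self-concordant functions. -/
lemma lower_bound (h : Assumptions f g) {x u : Space N} (hx : x ∈ effDom (obj f g))
    (hy : x + u ∈ effDom (obj f g)) :
    realVal f x + fderiv ℝ (realVal f) x u + omega (wNorm (hess f x) u) ≤ realVal f (x + u) := by
  rcases eq_or_ne u 0 with rfl | hu
  · simp [wNorm, omega_zero]
  · obtain ⟨φ₃, h₀, h₁, h₂, hpos, hsc⟩ := line_self_concordant h hu (T := 1)
      fun t ht => add_smul_mem_of_convex (convex_effDom_obj h) hx hy ht
    have := selfConcordant_lower h₀ h₁ h₂ hpos hsc (t := 1) ⟨zero_le_one, le_rfl⟩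
    simpa [wNorm] using this

/-- The upper bound on a segment contained in the domain. -/
lemma upper_bound_of_segment (h : Assumptions f g) {x u : Space N} {T : ℝ} (hT0 : 0 ≤ T)
    (hT : ∀ t ∈ Set.Icc 0 T, x + t • u ∈ effDom (obj f g)) (hr : T * wNorm (hess f x) u < 1) :
    realVal f (x + T • u) ≤ realVal f x + T * fderiv ℝ (realVal f) x u -
      T * wNorm (hess f x) u - Real.log (1 - T * wNorm (hess f x) u) := by
  rcases eq_or_ne u 0 with rfl | hu
  · simp [wNorm]
  · obtain ⟨φ₃, h₀, h₁, h₂, hpos, hsc⟩ := line_self_concordant h hu hT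
    have := selfConcordant_upper h₀ h₁ h₂ hpos hsc (t := T) ⟨hT0, le_rfl⟩
      (by simpa [wNorm] using hr)
    simpa [wNorm] using this

/-- The Dikin ellipsoid is contained in the domain. -/
lemma add_mem_effDom_of_wNorm_lt (h : Assumptions f g) {x u : Space N}
    (hx : x ∈ effDom (obj f g)) (hu : x + u ∈ sepDom g) (hr : wNorm (hess f x) u < 1) :
    x + u ∈ effDom (obj f g) := by
  obtain ⟨hxf, hxg⟩ := (mem_effDom_obj h).1 hx
  set r := wNorm (hess f x) u with hrdef
  have hr0 : 0 ≤ r := wNorm_nonneg _ _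
  -- K dominates the self-concordant upper bound at every t in [0,1]. Hence f ≤ K at each point of
  -- the segment that is known to lie in dom f.
  set K : ℝ := realVal f x + |fderiv ℝ (realVal f) x u| - Real.log (1 - r) with hK
  have hc : Continuous fun t : ℝ => x + t • u := by fun_prop
  set s : Set ℝ := {t | f (x + t • u) ≤ (K : EReal)} with hs
  have hclosed : IsClosed s := by
    have : IsClosed {y | f y ≤ (K : EReal)} := h.selfConcordant.closed.isClosed_preimage _
    exact this.preimage hc
  have hsdom : ∀ t ∈ s, x + t • u ∈ effDom f := fun t ht => lt_of_le_of_lt ht (EReal.coe_lt_top K)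
  have hlog : ∀ t ∈ Set.Icc (0 : ℝ) 1, Real.log (1 - r) ≤ Real.log (1 - t * r) := fun t ht =>
    Real.log_le_log (by linarith) (by nlinarith [ht.1, ht.2])
  have hseg : ∀ t ∈ Set.Icc (0 : ℝ) 1, x + t • u ∈ effDom f → t ∈ s := by
    intro t ht htf
    -- The upper bound needs the segment in dom F and not only in dom f, because positive
    -- definiteness of the Hessian is assumed on dom F.
    have hT : ∀ τ ∈ Set.Icc 0 t, x + τ • u ∈ effDom (obj f g) := by
      intro τ hτ
      have hτ1 : τ ∈ Set.Icc (0 : ℝ) 1 := ⟨hτ.1, hτ.2.trans ht.2⟩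
      refine (mem_effDom_obj h).2 ⟨?_, add_smul_mem_of_convex (convex_sepDom
        h.properClosedConvex) hxg hu hτ1⟩
      rcases eq_or_lt_of_le ht.1 with h0 | h0
      · have : τ = 0 := le_antisymm (h0 ▸ hτ.2) hτ.1
        simpa [this] using hxf
      · have := add_smul_mem_of_convex h.selfConcordant.convex.1 hxf htf (t := τ / t)
          ⟨div_nonneg hτ.1 h0.le, div_le_one_of_le₀ hτ.2 h0.le⟩
        rwa [smul_smul, div_mul_cancel₀ _ h0.ne'] at this
    have hle := upper_bound_of_segment h ht.1 hT (by nlinarith [ht.1, ht.2])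
    have hD : t * fderiv ℝ (realVal f) x u ≤ |fderiv ℝ (realVal f) x u| := by
      refine (le_abs_self _).trans ?_
      rw [abs_mul, abs_of_nonneg ht.1]
      exact mul_le_of_le_one_left (abs_nonneg _) ht.2
    change f (x + t • u) ≤ (K : EReal)
    rw [← coe_realVal h.selfConcordant.ne_bot htf, EReal.coe_le_coe_iff]
    have := hlog t ht
    have := mul_nonneg ht.1 hr0
    rw [← hrdef] at hle
    linarith
  have h0s : (0 : ℝ) ∈ s := hseg 0 ⟨le_rfl, zero_le_one⟩ (by simpa using hxf)
  -- Continuation argument: the set of t with f ≤ K is closed by lower semicontinuity. It extends to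
  -- the right because dom f is open and, on the segment, membership in dom f already implies f ≤ K.
  have hIcc : Set.Icc (0 : ℝ) 1 ⊆ s := by
    refine IsClosed.Icc_subset_of_forall_mem_nhdsWithin (hclosed.inter isClosed_Icc) h0s ?_
    rintro t ⟨hts, ht⟩
    have h1 : ∀ᶠ τ in nhdsWithin t (Set.Ioi t), x + τ • u ∈ effDom f :=
      nhdsWithin_le_nhds (hc.continuousAt.eventually_mem
        (h.selfConcordant.isOpen_dom.mem_nhds (hsdom t hts)))
    filter_upwards [h1, Ioc_mem_nhdsGT ht.2] with τ hτ hτ1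
    exact hseg τ ⟨ht.1.trans hτ1.1.le, hτ1.2⟩ hτ
  have h1 := hsdom 1 (hIcc ⟨zero_le_one, le_rfl⟩)
  rw [one_smul] at h1
  exact (mem_effDom_obj h).2 ⟨h1, hu⟩

/-- The objective after a damped step. -/
lemma obj_damped_step_le (h : Assumptions f g) {x u : Space N} (hx : x ∈ effDom (obj f g))
    (hu : x + u ∈ sepDom g) {t : ℝ} (ht : t ∈ Set.Icc (0 : ℝ) 1)
    (hr : t * wNorm (hess f x) u < 1) :
    x + t • u ∈ effDom (obj f g) ∧
    realVal (obj f g) (x + t • u) ≤ realVal (obj f g) x +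
      t * (fderiv ℝ (realVal f) x u + sepVal g (x + u) - sepVal g x) -
      t * wNorm (hess f x) u - Real.log (1 - t * wNorm (hess f x) u) := by
  obtain ⟨hxf, hxg⟩ := (mem_effDom_obj h).1 hx
  have hmemg := add_smul_mem_of_convex (convex_sepDom h.properClosedConvex) hxg hu ht
  have hmem : x + t • u ∈ effDom (obj f g) :=
    add_mem_effDom_of_wNorm_lt h hx hmemg (by rwa [wNorm_smul, abs_of_nonneg ht.1])
  refine ⟨hmem, ?_⟩
  have hT : ∀ τ ∈ Set.Icc 0 t, x + τ • u ∈ effDom (obj f g) := by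
    intro τ hτ
    rcases eq_or_lt_of_le ht.1 with h0 | h0
    · have : τ = 0 := le_antisymm (h0 ▸ hτ.2) hτ.1
      simpa [this] using hx
    · have := add_smul_mem_of_convex (convex_effDom_obj h) hx hmem (t := τ / t)
        ⟨div_nonneg hτ.1 h0.le, div_le_one_of_le₀ hτ.2 h0.le⟩
      rwa [smul_smul, div_mul_cancel₀ _ h0.ne'] at this
  have h1 := upper_bound_of_segment h ht.1 hT hr
  have h2 := sepVal_add_smul_le h.properClosedConvex hxg hu ht
  rw [realVal_obj h hmem, realVal_obj h hx]
  linarith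

end SelfConcordance

/-! ### Minimizers of F. -/

section Optimality

variable {n : ℕ} {N : Fin n → ℕ} {f : Space N → EReal} {g : ∀ i, Block N i → EReal}

lemma mem_effDom_of_le {E : Type*} {φ : E → EReal} {x y : E} (hx : x ∈ effDom φ)
    (hy : φ y ≤ φ x) : y ∈ effDom φ := lt_of_le_of_lt hy hx

lemma realVal_obj_le (h : Assumptions f g) {x y : Space N} (hx : x ∈ effDom (obj f g))
    (hy : obj f g y ≤ obj f g x) : realVal (obj f g) y ≤ realVal (obj f g) x :=
  EReal.toReal_le_toReal hy (obj_ne_bot h y) (ne_of_lt hx)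

lemma obj_le_of_realVal_le (h : Assumptions f g) {x y : Space N} (hx : x ∈ effDom (obj f g))
    (hy : y ∈ effDom (obj f g)) (hle : realVal (obj f g) y ≤ realVal (obj f g) x) :
    obj f g y ≤ obj f g x := by
  rw [← coe_realVal (obj_ne_bot h) hx, ← coe_realVal (obj_ne_bot h) hy]
  exact EReal.coe_le_coe_iff.2 hle

lemma optVal_eq {z : Space N} (hz : ∀ y, obj f g z ≤ obj f g y) :
    optVal f g = realVal (obj f g) z := by
  unfold optVal realVal
  rw [le_antisymm (iInf_le _ z) (le_iInf hz)]

lemma optVal_le (h : Assumptions f g) {z : Space N} (hz : ∀ y, obj f g z ≤ obj f g y)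
    {x : Space N} (hx : x ∈ effDom (obj f g)) : optVal f g ≤ realVal (obj f g) x := by
  rw [optVal_eq hz]
  exact realVal_obj_le h hx (hz x)

/-- First-order optimality of a minimizer. -/
lemma optimality (h : Assumptions f g) {z : Space N} (hz : ∀ y, obj f g z ≤ obj f g y)
    (hzd : z ∈ effDom (obj f g)) {u : Space N} (hu : z + u ∈ sepDom g) :
    0 ≤ fderiv ℝ (realVal f) z u + (sepVal g (z + u) - sepVal g z) := by
  obtain ⟨hzf, hzg⟩ := (mem_effDom_obj h).1 hzd
  have hderiv := hasDerivAt_line (φ := realVal f) (x := z) (u := u) (t := 0)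
    (by simpa using h.selfConcordant.differentiableAt hzf)
  simp only [zero_smul, add_zero] at hderiv
  have hslope := hderiv.tendsto_slope_zero_right
  simp only [zero_add, zero_smul, add_zero, smul_eq_mul] at hslope
  have hc : Continuous fun s : ℝ => z + s • u := by fun_prop
  have hev : ∀ᶠ t in nhdsWithin (0 : ℝ) (Set.Ioi 0), z + t • u ∈ effDom f :=
    nhdsWithin_le_nhds (hc.continuousAt.eventually_mem
      (h.selfConcordant.isOpen_dom.mem_nhds (by simpa using hzf)))
  -- Minimality gives F(z+tu) ≥ F(z), and convexity bounds the increase of ∑ g_i by t times its full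
  -- increase. Dividing by t > 0 bounds the difference quotients of f from below.
  have hge : -(sepVal g (z + u) - sepVal g z) ≤ fderiv ℝ (realVal f) z u := by
    refine ge_of_tendsto hslope ?_
    filter_upwards [hev, Ioc_mem_nhdsGT zero_lt_one] with t ht ht1
    have ht1' : t ∈ Set.Icc (0 : ℝ) 1 := ⟨ht1.1.le, ht1.2⟩
    have hg := sepVal_add_smul_le h.properClosedConvex hzg hu ht1'
    have hd : z + t • u ∈ effDom (obj f g) := (mem_effDom_obj h).2
      ⟨ht, add_smul_mem_of_convex (convex_sepDom h.properClosedConvex) hzg hu ht1'⟩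
    have hle := realVal_obj_le h hd (hz _)
    rw [realVal_obj h hd, realVal_obj h hzd] at hle
    rw [inv_mul_eq_div, le_div_iff₀ ht1.1]
    linarith
  linarith

end Optimality

/-! ### Inexact directions and the decrease of F along them. -/

section Direction

variable {n : ℕ} {N : Fin n → ℕ} {f : Space N → EReal} {g : ∀ i, Block N i → EReal}
  {η : ℝ} {d : ∀ i, Space N → Block N i} {x : Space N}

/-- The predicted change of `F` along the `i`-th direction. -/
noncomputable def predChange (f : Space N → EReal) (g : ∀ i, Block N i → EReal)
    (d : ∀ i, Space N → Block N i) (i : Fin n) (x : Space N) : ℝ :=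
  (gradBlock f i x).ofLp ⬝ᵥ (d i x).ofLp +
    (realVal (g i) (block i x + d i x) - realVal (g i) (block i x))

lemma lam_nonneg (f : Space N → EReal) (d : ∀ i, Space N → Block N i) (i : Fin n) (x : Space N) :
    0 ≤ lam f d i x := wNorm_nonneg _ _

/-- The subgradient inequality at x_i + d_i is tested at x_i + e. The Hessian term and the residual
v are estimated by Cauchy-Schwarz in the local norm, which produces the factors 1-η and 1+η. It is
used with e = 0 and with e the displacement to the minimizer. -/
lemma direction_inequality (h : Assumptions f g) (hd : IsInexactDirection f g η d)
    (hx : x ∈ effDom (obj f g)) (i : Fin n) :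
    block i x + d i x ∈ effDom (g i) ∧ ∀ e : Block N i, block i x + e ∈ effDom (g i) →
      realVal (g i) (block i x + d i x) + (gradBlock f i x).ofLp ⬝ᵥ (d i x).ofLp +
        (1 - η) * lam f d i x ^ 2 ≤
      realVal (g i) (block i x + e) + (gradBlock f i x).ofLp ⬝ᵥ e.ofLp +
        (1 + η) * (lam f d i x * wNorm (hessBlock f i x) e) := by
  obtain ⟨v, ⟨s, hs, hv⟩, hvle⟩ := hd x hx i
  have hg := h.properClosedConvex i
  have hH := posDef_hessBlock (h.posDef x hx) i
  set lm := lam f d i x with hlm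
  have hlm0 : 0 ≤ lm := lam_nonneg _ _ _ _
  -- Were g_i infinite at x_i + d_i, the subgradient inequality would make it infinite everywhere,
  -- against properness.
  have hdom : block i x + d i x ∈ effDom (g i) := by
    obtain ⟨y, hy⟩ := hg.proper
    change g i _ < ⊤
    refine lt_top_iff_ne_top.2 fun ht => ?_
    have := hs y
    rw [ht, EReal.top_add_of_ne_bot (EReal.coe_ne_bot _)] at this
    exact absurd hy (not_lt.2 this)
  refine ⟨hdom, fun e he => ?_⟩
  have hsub := hs (block i x + e)
  rw [← coe_realVal hg.ne_bot hdom, ← coe_realVal hg.ne_bot he, ← EReal.coe_add,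
    EReal.coe_le_coe_iff, add_sub_add_left_eq_sub, inner_eq_dotProduct] at hsub
  have hs' : s.ofLp = -v.ofLp - (gradBlock f i x).ofLp -
      (hessBlock f i x).mulVec (d i x).ofLp := by
    have : s = -v - gradBlock f i x -
        WithLp.toLp 2 ((hessBlock f i x).mulVec (d i x).ofLp) := by rw [hv]; abel
    rw [this]; rfl
  rw [hs', WithLp.ofLp_sub] at hsub
  simp only [dotProduct_sub, sub_dotProduct, neg_dotProduct] at hsub
  have hq : (hessBlock f i x).mulVec (d i x).ofLp ⬝ᵥ (d i x).ofLp = lm ^ 2 := by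
    rw [dotProduct_comm, hlm]
    exact (wNorm_sq hH.posSemidef _).symm
  have h1 := (abs_le.1 (abs_dotProduct_mulVec_le hH.posSemidef e (d i x))).2
  rw [dotProduct_comm] at h1
  have h2 := (abs_le.1 (abs_dotProduct_le_wDualNorm hH v e)).2
  have h3 := (abs_le.1 (abs_dotProduct_le_wDualNorm hH v (d i x))).1
  have h4 := mul_le_mul_of_nonneg_right hvle (wNorm_nonneg (hessBlock f i x) e)
  have h5 := mul_le_mul_of_nonneg_right hvle (wNorm_nonneg (hessBlock f i x) (d i x))
  rw [show wNorm (hessBlock f i x) (d i x) = lm from rfl] at *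
  nlinarith

lemma predChange_le (h : Assumptions f g) (hd : IsInexactDirection f g η d)
    (hx : x ∈ effDom (obj f g)) (i : Fin n) :
    predChange f g d i x ≤ -((1 - η) * lam f d i x ^ 2) := by
  have := (direction_inequality h hd hx i).2 0
    (by simpa using ((mem_effDom_obj h).1 hx).2 i)
  have h0 : wNorm (hessBlock f i x) 0 = 0 := by simp [wNorm]
  simp only [h0, add_zero, WithLp.ofLp_zero, dotProduct_zero, mul_zero] at this
  unfold predChange
  linarith

lemma add_assemble_mem (h : Assumptions f g) (hd : IsInexactDirection f g η d)
    (hx : x ∈ effDom (obj f g)) : x + assemble (fun i => d i x) ∈ sepDom g := fun i =>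
  (direction_inequality h hd hx i).1

lemma fderiv_eq_sum_gradBlock (f : Space N → EReal) (x u : Space N) :
    fderiv ℝ (realVal f) x u = ∑ i, (gradBlock f i x).ofLp ⬝ᵥ (block i u).ofLp := by
  rw [← gradient_dotProduct, dotProduct_eq_sum_block]
  rfl

lemma sum_predChange (f : Space N → EReal) (g : ∀ i, Block N i → EReal)
    (d : ∀ i, Space N → Block N i) (x : Space N) :
    ∑ i, predChange f g d i x = fderiv ℝ (realVal f) x (assemble fun i => d i x) +
      (sepVal g (x + assemble fun i => d i x) - sepVal g x) := by
  rw [fderiv_eq_sum_gradBlock]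
  unfold predChange sepVal
  rw [Finset.sum_add_distrib, Finset.sum_sub_distrib]
  rfl

/-- The total predicted change is compared with an arbitrary displacement. -/
lemma sum_predChange_le (h : Assumptions f g) (hd : IsInexactDirection f g η d)
    (hx : x ∈ effDom (obj f g)) {e : Space N} (he : x + e ∈ sepDom g) :
    ∑ i, predChange f g d i x ≤ fderiv ℝ (realVal f) x e + (sepVal g (x + e) - sepVal g x) -
      (1 - η) * ∑ i, lam f d i x ^ 2 +
      (1 + η) * ∑ i, lam f d i x * wNorm (hessBlock f i x) (block i e) := by
  rw [fderiv_eq_sum_gradBlock]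
  unfold predChange sepVal
  rw [← Finset.sum_sub_distrib, Finset.mul_sum, Finset.mul_sum, ← Finset.sum_add_distrib,
    ← Finset.sum_sub_distrib, ← Finset.sum_add_distrib]
  refine Finset.sum_le_sum fun i _ => ?_
  have := (direction_inequality h hd hx i).2 (block i e) (he i)
  rw [block_add]
  linarith

/-- The displacement is z - x, and f(x) + ⟨∇f(x), z-x⟩ ≤ f(z) turns the linear term into the gap.
Here the remainder ω of `lower_bound` is simply discarded. -/
lemma obj_sub_optVal_ge_predChange (h : Assumptions f g)
    (hd : IsInexactDirection f g η d) (hx : x ∈ effDom (obj f g)) {z : Space N}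
    (hz : ∀ y, obj f g z ≤ obj f g y) :
    ∑ i, predChange f g d i x ≤ -(realVal (obj f g) x - optVal f g) -
      (1 - η) * ∑ i, lam f d i x ^ 2 +
      (1 + η) * ∑ i, lam f d i x * wNorm (hessBlock f i x) (block i (z - x)) := by
  have hzd := mem_effDom_of_le hx (hz x)
  have hxz : x + (z - x) = z := by abel
  have h1 := sum_predChange_le h hd hx (e := z - x)
    (by rw [hxz]; exact ((mem_effDom_obj h).1 hzd).2)
  have h2 := lower_bound h hx (u := z - x) (by rwa [hxz])
  have h3 := omega_nonneg (wNorm_nonneg (hess f x) (z - x))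
  rw [hxz] at h1 h2
  rw [optVal_eq hz, realVal_obj h hx, realVal_obj h hzd]
  linarith

/-- One damped block step. -/
noncomputable def blockStep (f : Space N → EReal) (d : ∀ i, Space N → Block N i) (i : Fin n) (x : Space N) :
    Space N :=
  x + (1 / (1 + lam f d i x)) • embed i (d i x)

lemma sepVal_add_embed_sub (g : ∀ i, Block N i → EReal) (x : Space N) (i : Fin n)
    (u : Block N i) : sepVal g (x + embed i u) - sepVal g x =
      realVal (g i) (block i x + u) - realVal (g i) (block i x) := by
  unfold sepVal
  rw [← Finset.sum_sub_distrib, Finset.sum_eq_single i]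
  · simp
  · intro j _ hj
    simp [block_embed_of_ne hj]
  · simp

/-- The step length t = 1/(1+λ) gives tλ = λ/(1+λ) < 1, hence the step stays in the Dikin ellipsoid,
and 1 - tλ = 1/(1+λ) turns the barrier term into log(1+λ). -/
lemma blockStep_spec (h : Assumptions f g) (hd : IsInexactDirection f g η d)
    (hx : x ∈ effDom (obj f g)) (i : Fin n) :
    blockStep f d i x ∈ effDom (obj f g) ∧
    realVal (obj f g) (blockStep f d i x) ≤ realVal (obj f g) x +
      1 / (1 + lam f d i x) * predChange f g d i x - lam f d i x / (1 + lam f d i x) +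
      Real.log (1 + lam f d i x) := by
  set lm := lam f d i x with hlm
  have hlm0 : 0 ≤ lm := lam_nonneg _ _ _ _
  have hw : wNorm (hess f x) (embed i (d i x)) = lm := wNorm_embed f x i _
  have hmem : x + embed i (d i x) ∈ sepDom g := by
    intro j
    by_cases hj : j = i
    · subst hj
      simpa using (direction_inequality h hd hx j).1
    · simpa [block_embed_of_ne hj] using ((mem_effDom_obj h).1 hx).2 j
  have hlt : 1 / (1 + lm) * lm < 1 := by
    rw [one_div_mul_eq_div, div_lt_one (by positivity)]
    linarith
  have := obj_damped_step_le h hx hmem (t := 1 / (1 + lm))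
    ⟨by positivity, by rw [div_le_one (by positivity)]; linarith⟩ (by rwa [hw])
  refine ⟨this.1, this.2.trans (le_of_eq ?_)⟩
  have hlog : Real.log (1 - 1 / (1 + lm) * lm) = -Real.log (1 + lm) := by
    rw [← Real.log_inv]
    congr 1
    field_simp
    ring
  have hpc : fderiv ℝ (realVal f) x (embed i (d i x)) + sepVal g (x + embed i (d i x)) -
      sepVal g x = predChange f g d i x := by
    rw [add_sub_assoc, sepVal_add_embed_sub, ← gradient_dotProduct, dotProduct_embed]
    rfl
  rw [hw, hlog, hpc]
  ring

/-- The decrease of the objective in one damped block step. -/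
lemma blockStep_decrease (h : Assumptions f g) (hd : IsInexactDirection f g η d)
    (hx : x ∈ effDom (obj f g)) (i : Fin n) :
    realVal (obj f g) (blockStep f d i x) ≤ realVal (obj f g) x -
      (omega (lam f d i x) - η * lam f d i x ^ 2 / (1 + lam f d i x)) := by
  have h1 := (blockStep_spec h hd hx i).2
  have h2 := predChange_le h hd hx i
  set lm := lam f d i x with hlm
  have hlm0 : 0 ≤ lm := lam_nonneg _ _ _ _
  have h3 : 1 / (1 + lm) * predChange f g d i x ≤ 1 / (1 + lm) * -((1 - η) * lm ^ 2) :=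
    mul_le_mul_of_nonneg_left h2 (by positivity)
  have h4 : omega lm - η * lm ^ 2 / (1 + lm) =
      -(1 / (1 + lm) * -((1 - η) * lm ^ 2)) + lm / (1 + lm) - Real.log (1 + lm) := by
    unfold omega
    field_simp
    ring
  linarith

lemma omega_sub_ge {l : ℝ} (hl : 0 ≤ l) (hη : η ≤ 1 / 4) :
    l ^ 2 * (3 / (6 + 4 * l) - 1 / (4 * (1 + l))) ≤ omega l - η * l ^ 2 / (1 + l) := by
  have h1 := omega_ge hl
  have h2 : η * l ^ 2 / (1 + l) ≤ 1 / 4 * l ^ 2 / (1 + l) := by gcongr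
  have h3 : l ^ 2 * (3 / (6 + 4 * l) - 1 / (4 * (1 + l))) =
      3 * l ^ 2 / (6 + 4 * l) - 1 / 4 * l ^ 2 / (1 + l) := by
    field_simp
  linarith

lemma decrease_nonneg {l : ℝ} (hl : 0 ≤ l) (hη : η ≤ 1 / 4) :
    0 ≤ omega l - η * l ^ 2 / (1 + l) := by
  refine le_trans (mul_nonneg (sq_nonneg l) ?_) (omega_sub_ge hl hη)
  rw [sub_nonneg, div_le_div_iff₀ (by positivity) (by positivity)]
  nlinarith

/-- The factor of l² in `omega_sub_ge` equals (3+4l)/(4(3+2l)(1+l)): it is 1/4 at l = 0 and decays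
like 1/(2l). The condition ql ≤ 1 therefore keeps it above q/6. -/
lemma decrease_ge {l q : ℝ} (hl : 0 ≤ l) (hη : η ≤ 1 / 4) (hq : q ≤ 1)
    (hql : q * l ≤ 1) : q / 6 * l ^ 2 ≤ omega l - η * l ^ 2 / (1 + l) := by
  refine le_trans ?_ (omega_sub_ge hl hη)
  rw [mul_comm]
  refine mul_le_mul_of_nonneg_left ?_ (sq_nonneg l)
  rw [div_sub_div _ _ (by positivity) (by positivity), div_le_div_iff₀ (by norm_num)
    (by positivity)]
  nlinarith [mul_nonneg hl (sub_nonneg.2 hql)]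

lemma decrease_ge_linear {l : ℝ} (hl : 1 ≤ l) (hη : η ≤ 1 / 4) :
    l / 10 ≤ omega l - η * l ^ 2 / (1 + l) := by
  refine le_trans ?_ (omega_sub_ge (by linarith) hη)
  rw [div_sub_div _ _ (by positivity) (by positivity), ← mul_div_assoc,
    div_le_div_iff₀ (by norm_num) (by positivity)]
  nlinarith [mul_nonneg (sub_nonneg.2 hl) (sub_nonneg.2 hl),
    mul_nonneg (sub_nonneg.2 hl) (mul_nonneg (sub_nonneg.2 hl) (sub_nonneg.2 hl))]

lemma blockStep_le (h : Assumptions f g) (hη : η ∈ Set.Icc (0 : ℝ) (1 / 4))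
    (hd : IsInexactDirection f g η d) (hx : x ∈ effDom (obj f g)) (i : Fin n) :
    realVal (obj f g) (blockStep f d i x) ≤ realVal (obj f g) x := by
  have := blockStep_decrease h hd hx i
  have := decrease_nonneg (lam_nonneg f d i x) hη.2
  linarith

/-- A block step cannot go below F*, while for λ_i ≥ 1 it gains at least λ_i/10. This bounds λ_i on
the level set and yields θ > 0. -/
lemma lam_le (h : Assumptions f g) (hη : η ∈ Set.Icc (0 : ℝ) (1 / 4))
    (hd : IsInexactDirection f g η d) (hx : x ∈ effDom (obj f g)) {z : Space N}
    (hz : ∀ y, obj f g z ≤ obj f g y) (i : Fin n) :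
    lam f d i x ≤ 1 + 10 * (realVal (obj f g) x - optVal f g) := by
  have h1 := blockStep_decrease h hd hx i
  have h2 := optVal_le h hz (blockStep_spec h hd hx i).1
  have h3 := optVal_le h hz hx
  rcases le_total (lam f d i x) 1 with hl | hl
  · linarith
  · have := decrease_ge_linear hl hη.2
    linarith

/-- The gap `F(x) - F^*` controls the local norms of the directions. -/
lemma omega_le_gap (h : Assumptions f g)
    (hd : IsInexactDirection f g η d) (hx : x ∈ effDom (obj f g)) {z : Space N}
    (hz : ∀ y, obj f g z ≤ obj f g y) {A B τ : ℝ} (hτ : 0 ≤ τ) (hA0 : 0 < A)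
    (hA : ∀ u, wNorm (blockDiagHess f x) u ≤ A * wNorm (hess f x) u)
    (hB : ∀ u, wNorm (hess f x) u ≤ B * wNorm (blockDiagHess f x) u)
    (hτA : τ * A ≤ Real.sqrt (∑ i, lam f d i x ^ 2))
    (hτB : τ * B ≤ (1 - η) * Real.sqrt (∑ i, lam f d i x ^ 2)) :
    omega τ ≤ realVal (obj f g) x - optVal f g := by
  set D : Space N := assemble fun i => d i x with hD
  have hpd := h.posDef x hx
  have hS0 : 0 ≤ ∑ i, lam f d i x ^ 2 := Finset.sum_nonneg fun i _ => sq_nonneg _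
  have hS : wNorm (blockDiagHess f x) D = Real.sqrt (∑ i, lam f d i x ^ 2) := by
    rw [← Real.sqrt_sq (wNorm_nonneg (blockDiagHess f x) D), wNorm_blockDiagHess_sq hpd]
    rfl
  set a := Real.sqrt (∑ i, lam f d i x ^ 2) with ha
  have ha2 : a ^ 2 = ∑ i, lam f d i x ^ 2 := Real.sq_sqrt hS0
  rcases eq_or_lt_of_le hτ with h0 | hτpos
  · rw [← h0, omega_zero, sub_nonneg]
    exact optVal_le h hz hx
  set ρ := wNorm (hess f x) D with hρ
  have hρ0 : 0 ≤ ρ := wNorm_nonneg _ _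
  have haρ : a ≤ A * ρ := by rw [← hS]; exact hA D
  have hρa : ρ ≤ B * a := by rw [← hS]; exact hB D
  have ha0 : 0 ≤ a := Real.sqrt_nonneg _
  rcases eq_or_lt_of_le hρ0 with hρz | hρpos
  · exfalso
    have hD0 : D = 0 := by
      by_contra hne
      exact (wNorm_pos hpd hne).ne hρz
    have ha00 : a = 0 := by
      rw [← hS, hD0]; simp [wNorm]
    rw [ha00] at hτA
    nlinarith [mul_pos hτpos hA0]
  have hτρ : τ ≤ ρ := by nlinarith
  -- The step length is chosen so that its product with ρ is τ/(1+τ). As τ ρ ≤ (1-η)a², the linear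
  -- decrease is at least τ²/(1+τ), and with the barrier terms the total decrease is at least ω(τ).
  have ht : τ / (ρ * (1 + τ)) ∈ Set.Icc (0 : ℝ) 1 :=
    ⟨by positivity, by rw [div_le_one (by positivity)]; nlinarith⟩
  have htρ : τ / (ρ * (1 + τ)) * ρ = τ / (1 + τ) := by field_simp
  have hlt : τ / (ρ * (1 + τ)) * ρ < 1 := by
    rw [htρ, div_lt_one (by positivity)]; linarith
  obtain ⟨hmem, hle⟩ := obj_damped_step_le h hx (add_assemble_mem h hd hx) ht hlt
  have hopt := optVal_le h hz hmem
  have hpred : fderiv ℝ (realVal f) x D + sepVal g (x + D) - sepVal g x ≤ -((1 - η) * a ^ 2) := by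
    rw [add_sub_assoc, ← sum_predChange, ha2, Finset.mul_sum, ← Finset.sum_neg_distrib]
    exact Finset.sum_le_sum fun i _ => predChange_le h hd hx i
  have hτρa : τ * ρ ≤ (1 - η) * a ^ 2 := by
    calc τ * ρ ≤ τ * (B * a) := mul_le_mul_of_nonneg_left hρa hτ
      _ = τ * B * a := by ring
      _ ≤ (1 - η) * a * a := mul_le_mul_of_nonneg_right hτB ha0
      _ = (1 - η) * a ^ 2 := by ring
  have hm := mul_le_mul_of_nonneg_left (hpred.trans (neg_le_neg hτρa)) ht.1
  have hm' : τ / (ρ * (1 + τ)) * -(τ * ρ) = -(τ ^ 2 / (1 + τ)) := by field_simp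
  have hlog : Real.log (1 - τ / (ρ * (1 + τ)) * ρ) = -Real.log (1 + τ) := by
    rw [htρ, ← Real.log_inv]
    congr 1
    field_simp
    ring
  rw [hlog, htρ] at hle
  have hω : omega τ = τ ^ 2 / (1 + τ) + τ / (1 + τ) - Real.log (1 + τ) := by
    unfold omega
    field_simp
    ring
  linarith

end Direction

/-! ### Compactness of the level set and the distance to the minimizer. -/

section LevelSet

variable {n : ℕ} {N : Fin n → ℕ} {f : Space N → EReal} {g : ∀ i, Block N i → EReal}
  {η : ℝ} {d : ∀ i, Space N → Block N i} {x₀ x z : Space N}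

lemma lowerSemicontinuous_add_of_ne_bot {E : Type*} [TopologicalSpace E] {φ ψ : E → EReal}
    (hφ : LowerSemicontinuous φ) (hψ : LowerSemicontinuous ψ) (hφb : ∀ x, φ x ≠ ⊥)
    (hψb : ∀ x, ψ x ≠ ⊥) : LowerSemicontinuous fun x => φ x + ψ x :=
  hφ.add' hψ fun x => EReal.continuousAt_add (Or.inr (hψb x)) (Or.inl (hφb x))

lemma lowerSemicontinuous_obj (h : Assumptions f g) : LowerSemicontinuous (obj f g) := by
  have hg : ∀ i, LowerSemicontinuous fun x : Space N => g i (block i x) := fun i =>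
    (h.properClosedConvex i).closed.comp (continuous_block i)
  have hgb : ∀ i (x : Space N), g i (block i x) ≠ ⊥ := fun i x =>
    (h.properClosedConvex i).ne_bot _
  have hsum : ∀ s : Finset (Fin n), LowerSemicontinuous fun x : Space N =>
      ∑ i ∈ s, g i (block i x) := by
    intro s
    induction s using Finset.induction_on with
    | empty => simpa using lowerSemicontinuous_const
    | insert i s hi ih =>
      simp only [Finset.sum_insert hi]
      exact lowerSemicontinuous_add_of_ne_bot (hg i) ih (hgb i)
        fun x => sum_ne_bot s fun j => hgb j x
  exact lowerSemicontinuous_add_of_ne_bot h.selfConcordant.closed (hsum _)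
    h.selfConcordant.ne_bot fun x => sum_ne_bot _ fun j => hgb j x

lemma mem_effDom_of_mem_levelSet (hx₀ : x₀ ∈ effDom (obj f g)) (hx : x ∈ levelSet f g x₀) :
    x ∈ effDom (obj f g) := mem_effDom_of_le hx₀ hx

lemma continuousOn_fderiv_fderiv (h : Assumptions f g) :
    ContinuousOn (fderiv ℝ (fderiv ℝ (realVal f))) (effDom (obj f g)) := fun _ hx =>
  (h.selfConcordant.contDiffAt_fderiv_fderiv
    ((mem_effDom_obj h).1 hx).1).continuousAt.continuousWithinAt

/-- The Hessian form is continuous and positive on the compact product of K with the unit sphere, so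
it has a positive minimum there; homogeneity extends the bound to all vectors. -/
lemma exists_uniform_lower (h : Assumptions f g) {K : Set (Space N)} (hK : IsCompact K)
    (hKd : K ⊆ effDom (obj f g)) :
    ∃ c > 0, ∀ x ∈ K, ∀ u : Space N, c * ‖u‖ ^ 2 ≤ u.ofLp ⬝ᵥ (hess f x).mulVec u.ofLp := by
  set q : Space N × Space N → ℝ := fun p => fderiv ℝ (fderiv ℝ (realVal f)) p.1 p.2 p.2 with hq
  have hcomp : IsCompact (K ×ˢ Metric.sphere (0 : Space N) 1) := hK.prod (isCompact_sphere _ _)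
  have hcont : ContinuousOn q (K ×ˢ Metric.sphere (0 : Space N) 1) := by
    have h1 : ContinuousOn (fun p : Space N × Space N => fderiv ℝ (fderiv ℝ (realVal f)) p.1)
        (K ×ˢ Metric.sphere (0 : Space N) 1) :=
      (continuousOn_fderiv_fderiv h).comp continuousOn_fst fun p hp => hKd hp.1
    exact (h1.clm_apply continuousOn_snd).clm_apply continuousOn_snd
  have hscale : ∀ c : ℝ, (∀ x ∈ K, ∀ u : Space N, ‖u‖ = 1 → c ≤ q (x, u)) →
      ∀ x ∈ K, ∀ u : Space N, c * ‖u‖ ^ 2 ≤ u.ofLp ⬝ᵥ (hess f x).mulVec u.ofLp := by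
    intro c hc x hx u
    rcases eq_or_ne u 0 with rfl | hu
    · simp
    have hu' := norm_pos_iff.2 hu
    have := hc x hx (‖u‖⁻¹ • u) (by rw [norm_smul, norm_inv, norm_norm, inv_mul_cancel₀ hu'.ne'])
    rw [← hess_quadForm]
    simp only [hq, map_smul, smul_apply, smul_eq_mul] at this
    have h2 : ‖u‖ ^ 2 * (‖u‖⁻¹ * (‖u‖⁻¹ * fderiv ℝ (fderiv ℝ (realVal f)) x u u)) =
        fderiv ℝ (fderiv ℝ (realVal f)) x u u := by field_simp
    rw [← h2, mul_comm]
    exact mul_le_mul_of_nonneg_left this (by positivity)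
  -- The product is empty if K is empty or the space is zero-dimensional; any positive constant then
  -- works.
  rcases (K ×ˢ Metric.sphere (0 : Space N) 1).eq_empty_or_nonempty with hem | hne
  · refine ⟨1, one_pos, hscale 1 fun x hx u hu => ?_⟩
    have : (x, u) ∈ K ×ˢ Metric.sphere (0 : Space N) 1 := ⟨hx, by simpa using hu⟩
    rw [hem] at this
    exact this.elim
  · obtain ⟨⟨y, w⟩, ⟨hy, hw⟩, hmin⟩ := hcomp.exists_isMinOn hne hcont
    refine ⟨q (y, w), ?_, hscale _ fun x hx u hu => hmin ⟨hx, by simpa using hu⟩⟩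
    have hw0 : w ≠ 0 := by
      rintro rfl
      simp at hw
    have hw' : w.ofLp ≠ 0 := fun h0 => hw0 (by ext i; simp [h0])
    have := (h.posDef y (hKd hy)).dotProduct_mulVec_pos hw'
    rwa [star_trivial, ← hess_quadForm] at this

lemma le_of_omega_le {t C : ℝ} (ht : 0 ≤ t) (hC : omega t ≤ C) : t ≤ 1 + 4 * C := by
  have hC0 : 0 ≤ C := (omega_nonneg ht).trans hC
  rcases le_total t 1 with h1 | h1
  · linarith
  have h2 := (omega_ge ht).trans hC
  rw [div_le_iff₀ (by positivity)] at h2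
  nlinarith

/-- Closedness is lower semicontinuity. For boundedness, the self-concordant lower bound at the
minimizer z and first-order optimality give ω(‖x-z‖_z) ≤ F(x) - F*, and ω is unbounded. -/
lemma isCompact_levelSet (h : Assumptions f g) (hx₀ : x₀ ∈ effDom (obj f g)) :
    IsCompact (levelSet f g x₀) := by
  obtain ⟨z, hz, -⟩ := h.unique_min
  have hzd := mem_effDom_of_le hx₀ (hz x₀)
  refine Metric.isCompact_of_isClosed_isBounded
    ((lowerSemicontinuous_obj h).isClosed_preimage _) ?_
  obtain ⟨c, hc, hcl⟩ := exists_uniform_lower h (isCompact_singleton (x := z))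
    (Set.singleton_subset_iff.2 hzd)
  set R := 1 + 4 * (realVal (obj f g) x₀ - optVal f g) with hR
  refine (Metric.isBounded_iff_subset_closedBall z).2 ⟨R / Real.sqrt c, fun x hx => ?_⟩
  have hxd := mem_effDom_of_mem_levelSet hx₀ hx
  have hzx : z + (x - z) = x := by abel
  have h1 := lower_bound h hzd (u := x - z) (by rwa [hzx])
  have h2 := optimality h hz hzd (u := x - z) (by rw [hzx]; exact ((mem_effDom_obj h).1 hxd).2)
  have h3 := realVal_obj_le h hx₀ hx
  rw [hzx] at h1 h2
  have h4 : omega (wNorm (hess f z) (x - z)) ≤ realVal (obj f g) x₀ - optVal f g := by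
    rw [optVal_eq hz]
    rw [realVal_obj h hxd] at h3
    rw [realVal_obj h hzd]
    linarith
  have h5 := le_of_omega_le (wNorm_nonneg _ _) h4
  have h6 : Real.sqrt c * ‖x - z‖ ≤ wNorm (hess f z) (x - z) := by
    have := Real.sqrt_le_sqrt (hcl z rfl (x - z))
    rwa [Real.sqrt_mul hc.le, Real.sqrt_sq (norm_nonneg _)] at this
  rw [Metric.mem_closedBall, dist_eq_norm, le_div_iff₀ (Real.sqrt_pos.2 hc), mul_comm]
  exact h6.trans h5

lemma continuousOn_specNorm_hess (h : Assumptions f g) :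
    ContinuousOn (fun x => specNorm (hess f x)) (effDom (obj f g)) := by
  have h1 : ContinuousOn (hess f) (effDom (obj f g)) := by
    refine continuousOn_pi.2 fun a => continuousOn_pi.2 fun b => ?_
    exact ((continuousOn_fderiv_fderiv h).clm_apply continuousOn_const).clm_apply
      continuousOn_const
  have h2 : Continuous fun M : Matrix (Idx N) (Idx N) ℝ => specNorm M :=
    (LinearMap.continuous_of_finiteDimensional
      { toFun := Matrix.toEuclideanCLM (n := Idx N) (𝕜 := ℝ)
        map_add' := map_add _
        map_smul' := fun c M => map_smul _ c M }).norm
  exact h2.comp_continuousOn h1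

lemma specNorm_hess_le_LF (h : Assumptions f g) (hx₀ : x₀ ∈ effDom (obj f g))
    (hx : x ∈ levelSet f g x₀) : specNorm (hess f x) ≤ LF f g x₀ :=
  le_csSup ((isCompact_levelSet h hx₀).bddAbove_image ((continuousOn_specNorm_hess h).mono
    fun _ hy => mem_effDom_of_mem_levelSet hx₀ hy)) (Set.mem_image_of_mem _ hx)

/-- The space must have positive dimension: an empty spectrum would make `lamMin` the default value
0 of the infimum. -/
lemma sigmaF_pos_and_le [Nonempty (Idx N)] (h : Assumptions f g)
    (hx₀ : x₀ ∈ effDom (obj f g)) : 0 < sigmaF f g x₀ ∧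
      ∀ x ∈ levelSet f g x₀, ∀ u : Space N,
        sigmaF f g x₀ * ‖u‖ ^ 2 ≤ u.ofLp ⬝ᵥ (hess f x).mulVec u.ofLp := by
  obtain ⟨c, hc, hcl⟩ := exists_uniform_lower h (isCompact_levelSet h hx₀)
    fun _ hy => mem_effDom_of_mem_levelSet hx₀ hy
  have hle : ∀ x ∈ levelSet f g x₀, c ≤ lamMin (hess f x) := fun x hx =>
    le_lamMin (h.posDef x (mem_effDom_of_mem_levelSet hx₀ hx)).1 (hcl x hx)
  have hlb : ∀ y ∈ (fun x => lamMin (hess f x)) '' levelSet f g x₀, c ≤ y := by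
    rintro _ ⟨x, hx, rfl⟩
    exact hle x hx
  refine ⟨hc.trans_le (le_csInf ⟨_, Set.mem_image_of_mem _ (le_refl (obj f g x₀))⟩ hlb),
    fun x hx u => ?_⟩
  have h1 : sigmaF f g x₀ ≤ lamMin (hess f x) := csInf_le ⟨c, hlb⟩ (Set.mem_image_of_mem _ hx)
  exact (mul_le_mul_of_nonneg_right h1 (sq_nonneg _)).trans
    (lamMin_mul_norm_sq_le (h.posDef x (mem_effDom_of_mem_levelSet hx₀ hx)).1 u)

lemma convex_levelSet (h : Assumptions f g) (hx₀ : x₀ ∈ effDom (obj f g)) {u : Space N}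
    (hx : x ∈ levelSet f g x₀) (hu : x + u ∈ levelSet f g x₀) {t : ℝ}
    (ht : t ∈ Set.Icc (0 : ℝ) 1) : x + t • u ∈ levelSet f g x₀ := by
  have hxd := mem_effDom_of_mem_levelSet hx₀ hx
  have hud := mem_effDom_of_mem_levelSet hx₀ hu
  have htd := add_smul_mem_of_convex (convex_effDom_obj h) hxd hud ht
  refine obj_le_of_realVal_le h hx₀ htd ?_
  have h1 := sepVal_add_smul_le h.properClosedConvex ((mem_effDom_obj h).1 hxd).2
    ((mem_effDom_obj h).1 hud).2 ht
  have h2 := h.selfConcordant.convex.2 ((mem_effDom_obj h).1 hxd).1 ((mem_effDom_obj h).1 hud).1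
    (sub_nonneg.2 ht.2) ht.1 (by ring)
  have h3 : (1 - t) • x + t • (x + u) = x + t • u := by
    simp only [smul_add, sub_smul, one_smul]
    abel
  rw [h3, smul_eq_mul, smul_eq_mul] at h2
  have h4 := realVal_obj_le h hx₀ hx
  have h5 := realVal_obj_le h hx₀ hu
  rw [realVal_obj h hxd] at h4
  rw [realVal_obj h hud] at h5
  rw [realVal_obj h htd]
  have h6 := mul_le_mul_of_nonneg_left h4 (sub_nonneg.2 ht.2)
  have h7 := mul_le_mul_of_nonneg_left h5 ht.1
  linarith

/-- Mean value theorem along the segment. Convexity of the level set puts the intermediate point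
where σ_f and L_f are valid. -/
lemma exists_fderiv_sub_eq (h : Assumptions f g) (hx₀ : x₀ ∈ effDom (obj f g)) {u : Space N}
    (hx : x ∈ levelSet f g x₀) (hu : x + u ∈ levelSet f g x₀) (w : Space N) :
    ∃ y ∈ levelSet f g x₀, fderiv ℝ (realVal f) (x + u) w - fderiv ℝ (realVal f) x w =
      u.ofLp ⬝ᵥ (hess f y).mulVec w.ofLp := by
  have hmem : ∀ t ∈ Set.Icc (0 : ℝ) 1, x + t • u ∈ levelSet f g x₀ := fun t ht =>
    convex_levelSet h hx₀ hx hu ht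
  have hder : ∀ t ∈ Set.Icc (0 : ℝ) 1, HasDerivAt
      (fun t : ℝ => fderiv ℝ (realVal f) (x + t • u) w)
      (u.ofLp ⬝ᵥ (hess f (x + t • u)).mulVec w.ofLp) t := fun t ht =>
    hasDerivAt_line_fderiv h.selfConcordant
      ((mem_effDom_obj h).1 (mem_effDom_of_mem_levelSet hx₀ (hmem t ht))).1 w
  obtain ⟨t, ht, hts⟩ := exists_hasDerivAt_eq_slope _ _ zero_lt_one
    (fun t ht => (hder t ht).continuousAt.continuousWithinAt)
    fun t ht => hder t (Set.Ioo_subset_Icc_self ht)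
  refine ⟨_, hmem t (Set.Ioo_subset_Icc_self ht), ?_⟩
  rw [hts]
  simp

lemma mul_norm_sq_le_sum_lam_sq (h : Assumptions f g) (hxd : x ∈ effDom (obj f g)) {c : ℝ}
    (hc : ∀ u : Space N, c * ‖u‖ ^ 2 ≤ u.ofLp ⬝ᵥ (hess f x).mulVec u.ofLp) :
    c * ‖assemble fun i => d i x‖ ^ 2 ≤ ∑ i, lam f d i x ^ 2 := by
  rw [norm_sq_eq_sum_block, Finset.mul_sum]
  refine Finset.sum_le_sum fun i _ => ?_
  have := hc (embed i (d i x))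
  rw [norm_embed, ← wNorm_sq (h.posDef x hxd).posSemidef, wNorm_embed] at this
  exact this

lemma sum_lam_mul_wNorm_le {C : ℝ} (hC : specNorm (hess f x) ≤ C) (e : Space N) :
    ∑ i, lam f d i x * wNorm (hessBlock f i x) (block i e) ≤
      Real.sqrt C * (Real.sqrt (∑ i, lam f d i x ^ 2) * ‖e‖) := by
  have hC0 : 0 ≤ C := (specNorm_nonneg _).trans hC
  have h1 : ∀ i, wNorm (hessBlock f i x) (block i e) ≤ Real.sqrt C * ‖block i e‖ := by
    intro i
    rw [← wNorm_embed, ← norm_embed, ← Real.sqrt_sq (norm_nonneg (embed i (block i e))),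
      ← Real.sqrt_mul hC0]
    refine Real.sqrt_le_sqrt ?_
    have h2 := (abs_le.1 (abs_dotProduct_mulVec_le_specNorm (hess f x) (embed i (block i e))
      (embed i (block i e)))).2
    refine h2.trans ?_
    rw [mul_assoc, ← sq]
    exact mul_le_mul_of_nonneg_right hC (sq_nonneg _)
  have h2 : ∑ i, lam f d i x * ‖block i e‖ ≤ Real.sqrt (∑ i, lam f d i x ^ 2) * ‖e‖ := by
    have := Real.sum_mul_le_sqrt_mul_sqrt Finset.univ (fun i => lam f d i x)
      fun i => ‖block i e‖
    rwa [← norm_sq_eq_sum_block, Real.sqrt_sq (norm_nonneg _)] at this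
  calc ∑ i, lam f d i x * wNorm (hessBlock f i x) (block i e)
      ≤ ∑ i, Real.sqrt C * (lam f d i x * ‖block i e‖) :=
        Finset.sum_le_sum fun i _ => by
          have := mul_le_mul_of_nonneg_left (h1 i) (lam_nonneg f d i x)
          linarith
    _ = Real.sqrt C * ∑ i, lam f d i x * ‖block i e‖ := (Finset.mul_sum _ _ _).symm
    _ ≤ _ := mul_le_mul_of_nonneg_left h2 (Real.sqrt_nonneg _)

/-- The distance to the minimizer is controlled by the directions. -/
lemma sum_lam_mul_wNorm_sub_le [Nonempty (Idx N)] (h : Assumptions f g)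
    (hη : η ∈ Set.Icc (0 : ℝ) (1 / 4)) (hd : IsInexactDirection f g η d)
    (hx₀ : x₀ ∈ effDom (obj f g)) (hx : x ∈ levelSet f g x₀)
    (hz : ∀ y, obj f g z ≤ obj f g y) :
    1 ≤ LF f g x₀ / sigmaF f g x₀ ∧
    ∑ i, lam f d i x * wNorm (hessBlock f i x) (block i (z - x)) ≤
      (2 + η) * (LF f g x₀ / sigmaF f g x₀) ^ (3 / 2 : ℝ) * ∑ i, lam f d i x ^ 2 := by
  obtain ⟨hσ, hσle⟩ := sigmaF_pos_and_le h hx₀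
  set σ := sigmaF f g x₀ with hσdef
  set L := LF f g x₀ with hLdef
  have hxd := mem_effDom_of_mem_levelSet hx₀ hx
  have hLle : ∀ y ∈ levelSet f g x₀, ∀ u w : Space N,
      u.ofLp ⬝ᵥ (hess f y).mulVec w.ofLp ≤ L * ‖u‖ * ‖w‖ := fun y hy u w =>
    (abs_le.1 (abs_dotProduct_mulVec_le_specNorm _ u w)).2.trans
      (mul_le_mul_of_nonneg_right (mul_le_mul_of_nonneg_right (specNorm_hess_le_LF h hx₀ hy)
        (norm_nonneg _)) (norm_nonneg _))
  -- Both Hessian bounds are compared on a coordinate unit vector.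
  have hκ : 1 ≤ L / σ := by
    rw [one_le_div hσ]
    obtain ⟨q⟩ := ‹Nonempty (Idx N)›
    have h1 := hσle x hx (EuclideanSpace.single q 1)
    have h2 := hLle x hx (EuclideanSpace.single q 1) (EuclideanSpace.single q 1)
    simp only [PiLp.norm_single, norm_one, one_pow, mul_one] at h1 h2
    linarith
  refine ⟨hκ, ?_⟩
  have hLpos : 0 < L := by
    rw [one_le_div hσ] at hκ
    linarith
  set S := ∑ i, lam f d i x ^ 2 with hS
  have hS0 : 0 ≤ S := Finset.sum_nonneg fun i _ => sq_nonneg _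
  set a := Real.sqrt S with ha
  have ha0 : 0 ≤ a := Real.sqrt_nonneg _
  have ha2 : a ^ 2 = S := Real.sq_sqrt hS0
  set D : Space N := assemble fun i => d i x with hD
  set e := z - x with he
  set s := Real.sqrt σ with hs
  set l := Real.sqrt L with hl
  have hs0 : 0 < s := Real.sqrt_pos.2 hσ
  have hl0 : 0 < l := Real.sqrt_pos.2 hLpos
  have hs2 : s ^ 2 = σ := Real.sq_sqrt hσ.le
  have hl2 : l ^ 2 = L := Real.sq_sqrt hLpos.le
  have hxe : x + e = z := by rw [he]; abel
  have hzS : z ∈ levelSet f g x₀ := hz x₀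
  have hzd := mem_effDom_of_mem_levelSet hx₀ hzS
  have hW := sum_lam_mul_wNorm_le (d := d) (specNorm_hess_le_LF h hx₀ hx) e
  set W := ∑ i, lam f d i x * wNorm (hessBlock f i x) (block i e) with hWdef
  have hsD : s * ‖D‖ ≤ a := by
    have h1 := mul_norm_sq_le_sum_lam_sq (d := d) h hxd (hσle x hx)
    rw [← hs2, ← mul_pow] at h1
    exact Real.le_sqrt_of_sq_le h1
  -- The variational inequality of the directions is tested at z, and that of z is tested at x + D.
  -- In their sum the values of ∑ g_i cancel, which leaves ⟨∇f(z)-∇f(x), e⟩ ≤ ⟨∇f(z)-∇f(x), D⟩ +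
  -- (1+η)W.
  have h1 := sum_predChange_le h hd hxd (e := e)
    (by rw [hxe]; exact ((mem_effDom_obj h).1 hzd).2)
  rw [sum_predChange, hxe] at h1
  have hzD : z + (D - e) = x + D := by rw [he]; abel
  have h2 := optimality h hz hzd (u := D - e)
    (by rw [hzD]; exact add_assemble_mem h hd hxd)
  rw [hzD, map_sub] at h2
  obtain ⟨y₁, hy₁, h3⟩ := exists_fderiv_sub_eq h hx₀ hx (u := e) (by rwa [hxe]) e
  obtain ⟨y₂, hy₂, h4⟩ := exists_fderiv_sub_eq h hx₀ hx (u := e) (by rwa [hxe]) D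
  rw [hxe] at h3 h4
  have h5 := hσle y₁ hy₁ e
  have h6 := hLle y₂ hy₂ e D
  have hη1 : 0 ≤ (1 - η) * S := mul_nonneg (by linarith [hη.2]) hS0
  -- Strong convexity bounds the left side from below by σ‖e‖²; smoothness bounds the right side,
  -- with the term -(1-η)S dropped.
  have h7 : σ * ‖e‖ ^ 2 ≤ L * ‖e‖ * ‖D‖ + (1 + η) * (l * (a * ‖e‖)) := by
    have := mul_le_mul_of_nonneg_left hW (by linarith [hη.1] : 0 ≤ 1 + η)
    linarith
  -- One factor ‖e‖ is divided out and √σ‖D‖ ≤ a is inserted, so ‖e‖ is at most a constant times a.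
  -- The third power of s is the source of the exponent 3/2.
  have h8 : s ^ 3 * ‖e‖ ≤ (l ^ 2 + (1 + η) * l * s) * a := by
    rcases eq_or_lt_of_le (norm_nonneg e) with h0 | h0
    · rw [← h0, mul_zero]
      have := hη.1
      positivity
    · have h9 : σ * ‖e‖ ≤ L * ‖D‖ + (1 + η) * (l * a) := by
        refine le_of_mul_le_mul_right ?_ h0
        linarith
      rw [← hs2, ← hl2] at h9
      have h10 := mul_le_mul_of_nonneg_left h9 hs0.le
      have h11 := mul_le_mul_of_nonneg_left hsD (sq_nonneg l)
      linarith
  have hr : 1 ≤ l / s := by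
    rw [one_le_div hs0]
    rw [one_le_div hσ] at hκ
    exact Real.sqrt_le_sqrt hκ
  have hpow : (L / σ) ^ (3 / 2 : ℝ) = (l / s) ^ 3 := by
    rw [hl, hs, ← Real.sqrt_div hLpos.le, Real.sqrt_eq_rpow, ← Real.rpow_natCast,
      ← Real.rpow_mul (by positivity)]
    norm_num
  rw [hpow, ← ha2]
  calc W ≤ l * (a * ‖e‖) := hW
    _ ≤ l * (a * ((l ^ 2 + (1 + η) * l * s) * a / s ^ 3)) := by
        have : ‖e‖ ≤ (l ^ 2 + (1 + η) * l * s) * a / s ^ 3 := by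
          rw [le_div_iff₀ (by positivity)]
          linarith
        gcongr
    _ = ((l / s) ^ 3 + (1 + η) * (l / s) ^ 2) * a ^ 2 := by field_simp
    _ ≤ (2 + η) * (l / s) ^ 3 * a ^ 2 := by
        refine mul_le_mul_of_nonneg_right ?_ (sq_nonneg a)
        have h12 : (l / s) ^ 2 ≤ (l / s) ^ 3 := pow_le_pow_right₀ hr (by norm_num)
        have := mul_le_mul_of_nonneg_left h12 (by linarith [hη.1] : 0 ≤ 1 + η)
        linarith

end LevelSet

/-! ### The constants and the expected progress of one iteration. -/

section OneStep

variable {n : ℕ} {N : Fin n → ℕ} {f : Space N → EReal} {g : ∀ i, Block N i → EReal}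
  {η : ℝ} {d : ∀ i, Space N → Block N i} {p : Fin n → ℝ} {x₀ x z : Space N}

/-- The quantity whose maximum over the level set enters `c₁`. -/
noncomputable def condNum (f : Space N → EReal) (η : ℝ) (x : Space N) : ℝ :=
  (1 + η) * specNorm (matSqrt (blockDiagHess f x) * (matSqrt (hess f x))⁻¹) +
    specNorm ((matSqrt (blockDiagHess f x))⁻¹ * matSqrt (hess f x))

lemma pMin_le (p : Fin n → ℝ) (i : Fin n) : pMin p ≤ p i :=
  ciInf_le (Set.finite_range p).bddBelow i

lemma le_pMax (p : Fin n → ℝ) (i : Fin n) : p i ≤ pMax p :=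
  le_ciSup (Set.finite_range p).bddAbove i

lemma pMin_pos [Nonempty (Fin n)] (hp : ∀ i, 0 < p i) : 0 < pMin p := by
  obtain ⟨i, hi⟩ := exists_eq_ciInf_of_finite (f := p)
  unfold pMin
  rw [← hi]
  exact hp i

/-- Passing from one norm to the other and back shows that the product of the two spectral norms is
at least 1, hence their sum is at least 2. The lower bound 2 later absorbs the factor 2+η of the
distance estimate. -/
lemma condNum_bounds [Nonempty (Idx N)] (hη : 0 ≤ η) (hpd : (hess f x).PosDef) :
    0 < specNorm (matSqrt (blockDiagHess f x) * (matSqrt (hess f x))⁻¹) ∧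
      2 ≤ condNum f η x := by
  set A := specNorm (matSqrt (blockDiagHess f x) * (matSqrt (hess f x))⁻¹) with hA
  set B := specNorm ((matSqrt (blockDiagHess f x))⁻¹ * matSqrt (hess f x)) with hB
  have hHd := posDef_blockDiagHess hpd
  obtain ⟨q⟩ := ‹Nonempty (Idx N)›
  have hu : (EuclideanSpace.single q 1 : Space N) ≠ 0 := by simp
  set u : Space N := EuclideanSpace.single q 1
  have h1 := wNorm_le_specNorm_mul hHd.posSemidef hpd u
  have h2 := wNorm_le_specNorm_mul' hpd.posSemidef hHd u
  rw [← hA] at h1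
  rw [← hB] at h2
  have hA0 : 0 ≤ A := specNorm_nonneg _
  have hB0 : 0 ≤ B := specNorm_nonneg _
  have hH0 := wNorm_pos hHd hu
  have hAB : 1 ≤ A * B := by
    have h3 := mul_le_mul_of_nonneg_left h2 hA0
    refine le_of_mul_le_mul_right ?_ hH0
    linarith
  have hApos : 0 < A := by
    rcases eq_or_lt_of_le hA0 with h0 | h0
    · rw [← h0, zero_mul] at hAB
      linarith
    · exact h0
  refine ⟨hApos, ?_⟩
  have : condNum f η x = (1 + η) * A + B := rfl
  rw [this]
  nlinarith [sq_nonneg (A - B), mul_nonneg hη hA0]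

lemma c1_eq (f : Space N → EReal) (g : ∀ i, Block N i → EReal) (η : ℝ) (x₀ : Space N) :
    c1 f g η x₀ = (1 - η) / (Real.sqrt n * sSup (condNum f η '' levelSet f g x₀)) := rfl

/-- In the unbounded case the real supremum would be 0, hence c₁ = 0 and ω(c₁/p_min) = 0. Then x⁰ is
the minimizer and the level set is a single point, on which boundedness is trivial. -/
lemma bddAbove_condNum (h : Assumptions f g) (hx₀ : x₀ ∈ effDom (obj f g))
    (hloc : realVal (obj f g) x₀ ≤ optVal f g + omega (c1 f g η x₀ / pMin p)) :
    BddAbove (condNum f η '' levelSet f g x₀) := by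
  by_contra hb
  obtain ⟨z, hz, huniq⟩ := h.unique_min
  rw [c1_eq, Real.sSup_of_not_bddAbove hb, mul_zero, div_zero, zero_div, omega_zero,
    add_zero, optVal_eq hz] at hloc
  have hsub : levelSet f g x₀ ⊆ {z} := by
    intro y hy
    refine huniq y fun w => ?_
    exact (hy.trans (obj_le_of_realVal_le h (mem_effDom_of_le hx₀ (hz x₀)) hx₀ hloc)).trans (hz w)
  exact hb (((Set.finite_singleton z).subset hsub).image _).bddAbove

lemma theta_le [Nonempty (Fin n)] (hp : ∀ i, 0 < p i) (hx : x ∈ levelSet f g x₀) (i : Fin n) :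
    theta f g d p x₀ ≤ p i / (1 + lam f d i x) := by
  refine (ciInf_le (Set.finite_range _).bddBelow i).trans (csInf_le ⟨0, ?_⟩
    (Set.mem_image_of_mem _ hx))
  rintro _ ⟨y, -, rfl⟩
  have := lam_nonneg f d i y
  have := hp i
  positivity

lemma theta_pos [Nonempty (Fin n)] (h : Assumptions f g) (hη : η ∈ Set.Icc (0 : ℝ) (1 / 4))
    (hd : IsInexactDirection f g η d) (hx₀ : x₀ ∈ effDom (obj f g)) (hp : ∀ i, 0 < p i) :
    0 < theta f g d p x₀ := by
  obtain ⟨z, hz, -⟩ := h.unique_min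
  obtain ⟨i, hi⟩ := exists_eq_ciInf_of_finite
    (f := fun i => sInf ((fun x => p i / (1 + lam f d i x)) '' levelSet f g x₀))
  unfold theta
  rw [← hi]
  set C := 1 + 10 * (realVal (obj f g) x₀ - optVal f g) with hC
  have hC1 : 1 ≤ C := by
    have := optVal_le h hz hx₀
    linarith
  have hpos : 0 < p i / (1 + C) := div_pos (hp i) (by linarith)
  refine hpos.trans_le (le_csInf ⟨_, Set.mem_image_of_mem _ (le_refl (obj f g x₀))⟩ ?_)
  rintro _ ⟨x, hx, rfl⟩
  have h1 := lam_le h hη hd (mem_effDom_of_mem_levelSet hx₀ hx) hz i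
  have h2 := realVal_obj_le h hx₀ hx
  have h3 := lam_nonneg f d i x
  have := hp i
  exact div_le_div_of_nonneg_left (hp i).le (by linarith) (by linarith)

/-- This is where F(x⁰) - F* ≤ ω(c₁/p_min) is put to use: by monotonicity of ω the lower bound ω(τ)
on the gap gives √n p_min √S ≤ 1, and λ_i ≤ √S. -/
lemma pMin_mul_lam_le [Nonempty (Fin n)] [Nonempty (Idx N)] (h : Assumptions f g)
    (hη : η ∈ Set.Icc (0 : ℝ) (1 / 4)) (hd : IsInexactDirection f g η d)
    (hx₀ : x₀ ∈ effDom (obj f g)) (hp : ∀ i, 0 < p i)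
    (hloc : realVal (obj f g) x₀ ≤ optVal f g + omega (c1 f g η x₀ / pMin p))
    (hx : x ∈ levelSet f g x₀) (i : Fin n) : pMin p * lam f d i x ≤ 1 := by
  obtain ⟨z, hz, -⟩ := h.unique_min
  have hxd := mem_effDom_of_mem_levelSet hx₀ hx
  have hpd := h.posDef x hxd
  have hq := pMin_pos hp
  obtain ⟨hA0, hM2⟩ := condNum_bounds (η := η) hη.1 hpd
  have hMle : condNum f η x ≤ sSup (condNum f η '' levelSet f g x₀) :=
    le_csSup (bddAbove_condNum h hx₀ hloc) (Set.mem_image_of_mem _ hx)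
  rw [c1_eq] at hloc
  set M := sSup (condNum f η '' levelSet f g x₀) with hM
  set A := specNorm (matSqrt (blockDiagHess f x) * (matSqrt (hess f x))⁻¹) with hA
  set B := specNorm ((matSqrt (blockDiagHess f x))⁻¹ * matSqrt (hess f x)) with hB
  have hB0 : 0 ≤ B := specNorm_nonneg _
  have hcond : condNum f η x = (1 + η) * A + B := rfl
  set a := Real.sqrt (∑ i, lam f d i x ^ 2) with ha
  have ha0 : 0 ≤ a := Real.sqrt_nonneg _
  have hM0 : 0 < M := by linarith
  have hη1 : 0 < 1 - η := by linarith [hη.2]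
  have hηA : 0 ≤ η * A := mul_nonneg hη.1 hA0.le
  have hn : 1 ≤ Real.sqrt n := by
    rw [Real.one_le_sqrt, Nat.one_le_cast]
    exact Fin.pos_iff_nonempty.2 inferInstance
  -- This τ meets both requirements because M dominates (1+η)A + B, hence both (1-η)A and B.
  have hgap := omega_le_gap h hd hxd hz (A := A) (B := B) (τ := (1 - η) * a / M)
    (by positivity) hA0 (wNorm_le_specNorm_mul (posDef_blockDiagHess hpd).posSemidef hpd)
    (wNorm_le_specNorm_mul' hpd.posSemidef (posDef_blockDiagHess hpd))
    (by
      rw [div_mul_eq_mul_div, div_le_iff₀ hM0, ← ha, mul_right_comm, mul_comm]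
      refine mul_le_mul_of_nonneg_left ?_ ha0
      linarith)
    (by
      rw [div_mul_eq_mul_div, div_le_iff₀ hM0, ← ha]
      refine mul_le_mul_of_nonneg_left ?_ (by positivity)
      linarith)
  have hle := realVal_obj_le h hx₀ hx
  have hω : omega ((1 - η) * a / M) ≤ omega ((1 - η) / (Real.sqrt n * M) / pMin p) := by
    linarith
  have hcmp := (omega_strictMonoOn.le_iff_le (Set.mem_Ici.2 (by positivity))
    (Set.mem_Ici.2 (by positivity))).1 hω
  rw [div_div, mul_assoc, div_le_div_iff₀ hM0 (by positivity)] at hcmp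
  have hcmp' : a * (Real.sqrt n * pMin p) ≤ 1 := by
    refine le_of_mul_le_mul_left ?_ (mul_pos hη1 hM0)
    linarith
  have hla : lam f d i x ≤ a := by
    refine Real.le_sqrt_of_sq_le ?_
    exact Finset.single_le_sum (f := fun i => lam f d i x ^ 2) (fun i _ => sq_nonneg _)
      (Finset.mem_univ i)
  calc pMin p * lam f d i x ≤ pMin p * a := mul_le_mul_of_nonneg_left hla hq.le
    _ ≤ a * (Real.sqrt n * pMin p) := by
        have := mul_le_mul_of_nonneg_right hn (mul_nonneg ha0 hq.le)
        linarith
    _ ≤ 1 := hcmp'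

lemma sum_mul_decrease (h : Assumptions f g) [Nonempty (Fin n)] [Nonempty (Idx N)]
    (hη : η ∈ Set.Icc (0 : ℝ) (1 / 4)) (hd : IsInexactDirection f g η d)
    (hx₀ : x₀ ∈ effDom (obj f g)) (hp : ∀ i, 0 < p i) (hp_sum : ∑ i, p i = 1)
    (hloc : realVal (obj f g) x₀ ≤ optVal f g + omega (c1 f g η x₀ / pMin p))
    (hx : x ∈ levelSet f g x₀) :
    ∑ i, p i * realVal (obj f g) (blockStep f d i x) ≤
      realVal (obj f g) x - pMin p ^ 2 / 6 * ∑ i, lam f d i x ^ 2 := by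
  have hq := pMin_pos hp
  have hxd := mem_effDom_of_mem_levelSet hx₀ hx
  have hq1 : pMin p ≤ 1 := by
    obtain ⟨i⟩ := ‹Nonempty (Fin n)›
    refine (pMin_le p i).trans ?_
    rw [← hp_sum]
    exact Finset.single_le_sum (fun j _ => (hp j).le) (Finset.mem_univ i)
  calc ∑ i, p i * realVal (obj f g) (blockStep f d i x)
      ≤ ∑ i, (p i * realVal (obj f g) x - pMin p ^ 2 / 6 * lam f d i x ^ 2) := by
        refine Finset.sum_le_sum fun i _ => ?_
        have h1 := blockStep_decrease h hd hxd i
        have h2 := decrease_ge (lam_nonneg f d i x) hη.2 hq1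
          (pMin_mul_lam_le h hη hd hx₀ hp hloc hx i)
        have h3 : p i * realVal (obj f g) (blockStep f d i x) ≤
            p i * (realVal (obj f g) x - pMin p / 6 * lam f d i x ^ 2) :=
          mul_le_mul_of_nonneg_left (by linarith) (hp i).le
        have h4 : pMin p * (pMin p / 6 * lam f d i x ^ 2) ≤
            p i * (pMin p / 6 * lam f d i x ^ 2) :=
          mul_le_mul_of_nonneg_right (pMin_le p i) (by positivity)
        linarith
    _ = _ := by
        rw [Finset.sum_sub_distrib, ← Finset.sum_mul, hp_sum, one_mul, ← Finset.mul_sum]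

lemma log_sub_div_le {l : ℝ} (hl : 0 ≤ l) : Real.log (1 + l) - l / (1 + l) ≤ l ^ 2 / 2 := by
  have h1 := log_one_add_le hl
  have h2 : l * (6 + l) / (6 + 4 * l) - l / (1 + l) ≤ l ^ 2 / 2 := by
    rw [div_sub_div _ _ (by positivity) (by positivity), div_le_div_iff₀ (by positivity)
      (by norm_num)]
    nlinarith [pow_nonneg hl 2, pow_nonneg hl 3, pow_nonneg hl 4]
  linarith

lemma sum_mul_contraction (h : Assumptions f g) [Nonempty (Fin n)] [Nonempty (Idx N)]
    (hη : η ∈ Set.Icc (0 : ℝ) (1 / 4)) (hd : IsInexactDirection f g η d)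
    (hx₀ : x₀ ∈ effDom (obj f g)) (hp : ∀ i, 0 < p i) (hp_sum : ∑ i, p i = 1)
    (hloc : realVal (obj f g) x₀ ≤ optVal f g + omega (c1 f g η x₀ / pMin p))
    (hx : x ∈ levelSet f g x₀) :
    ∑ i, p i * realVal (obj f g) (blockStep f d i x) - optVal f g ≤
      (1 - theta f g d p x₀) * (realVal (obj f g) x - optVal f g) +
        c2 f g η d p x₀ * ∑ i, lam f d i x ^ 2 := by
  obtain ⟨z, hz, -⟩ := h.unique_min
  have hxd := mem_effDom_of_mem_levelSet hx₀ hx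
  obtain ⟨hA0, hM2⟩ := condNum_bounds (η := η) hη.1 (h.posDef x hxd)
  have hMle : condNum f η x ≤ sSup (condNum f η '' levelSet f g x₀) :=
    le_csSup (bddAbove_condNum h hx₀ hloc) (Set.mem_image_of_mem _ hx)
  obtain ⟨hκ, hdist⟩ := sum_lam_mul_wNorm_sub_le h hη hd hx₀ hx hz
  have hpred := obj_sub_optVal_ge_predChange h hd hxd hz
  have hθ := theta_pos (p := p) h hη hd hx₀ hp
  have hθle := fun i => theta_le (d := d) hp hx i
  have hη1 : 0 < 1 - η := by linarith [hη.2]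
  have hn : 0 < Real.sqrt n := Real.sqrt_pos.2 (by
    exact_mod_cast Fin.pos_iff_nonempty.2 inferInstance)
  set M := sSup (condNum f η '' levelSet f g x₀) with hM
  have hM0 : 0 < M := by linarith
  -- By the definition of c₁, c₁√n = (1-η)/M, and 1-η² = (1-η)(1+η).
  have hK : 2 * (1 - η ^ 2) / (c1 f g η x₀ * Real.sqrt n) = 2 * (1 + η) * M := by
    rw [c1_eq, ← hM]
    field_simp
    ring
  set κ := (LF f g x₀ / sigmaF f g x₀) ^ (3 / 2 : ℝ) with hκdef
  have hκ1 : 0 ≤ κ := Real.rpow_nonneg (by linarith) _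
  set θ := theta f g d p x₀ with hθdef
  set S := ∑ i, lam f d i x ^ 2 with hS
  have hS0 : 0 ≤ S := Finset.sum_nonneg fun i _ => sq_nonneg _
  set P := ∑ i, predChange f g d i x with hP
  have hθP : θ ≤ pMax p := by
    obtain ⟨i⟩ := ‹Nonempty (Fin n)›
    refine ((hθle i).trans (div_le_self (hp i).le ?_)).trans (le_pMax p i)
    linarith [lam_nonneg f d i x]
  have hstep : ∑ i, p i * realVal (obj f g) (blockStep f d i x) ≤
      realVal (obj f g) x + θ * P + pMax p / 2 * S := by
    calc ∑ i, p i * realVal (obj f g) (blockStep f d i x)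
        ≤ ∑ i, (p i * realVal (obj f g) x + θ * predChange f g d i x +
            pMax p / 2 * lam f d i x ^ 2) := by
          refine Finset.sum_le_sum fun i _ => ?_
          have h1 := mul_le_mul_of_nonneg_left (blockStep_spec h hd hxd i).2 (hp i).le
          have hl := lam_nonneg f d i x
          -- The predicted change is nonpositive, so its weight p_i/(1+λ_i) may be lowered to θ.
          have hneg : predChange f g d i x ≤ 0 := (predChange_le h hd hxd i).trans
            (neg_nonpos.2 (by positivity))
          have h2 := mul_le_mul_of_nonpos_right (hθle i) hneg
          have h3 := mul_le_mul_of_nonneg_left (log_sub_div_le hl) (hp i).le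
          have h4 := mul_le_mul_of_nonneg_right (le_pMax p i)
            (by positivity : 0 ≤ lam f d i x ^ 2 / 2)
          have h5 : p i * (1 / (1 + lam f d i x) * predChange f g d i x) =
              p i / (1 + lam f d i x) * predChange f g d i x := by ring
          linarith
      _ = _ := by
          rw [Finset.sum_add_distrib, Finset.sum_add_distrib, ← Finset.sum_mul, hp_sum, one_mul,
            ← Finset.mul_sum, ← Finset.mul_sum]
  have hP2 : P ≤ -(realVal (obj f g) x - optVal f g) - (1 - η) * S + κ * (2 * (1 + η) * M) * S := by
    have h1 := mul_le_mul_of_nonneg_left hdist (by linarith [hη.1] : 0 ≤ 1 + η)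
    have h2 : (1 + η) * ((2 + η) * κ * S) ≤ κ * (2 * (1 + η) * M) * S := by
      -- M ≥ 2 gives 2M ≥ 4, which exceeds 2+η.
      have h3 : (1 + η) * (2 + η) ≤ 2 * (1 + η) * M := by nlinarith [hη.1, hη.2]
      have := mul_le_mul_of_nonneg_right h3 (mul_nonneg hκ1 hS0)
      linarith
    linarith
  have hθP2 := mul_le_mul_of_nonneg_left hP2 hθ.le
  have hc2 : θ * (κ * (2 * (1 + η) * M) - 1) + (1 / 2 + η) * pMax p ≤ c2 f g η d p x₀ := by
    unfold c2
    rw [hK]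
    exact le_abs_self _
  have hc2S := mul_le_mul_of_nonneg_right hc2 hS0
  -- The coefficient -(1-η) contributes -1 to the bracket of c₂; the remaining θη is absorbed into η
  -- p_max.
  have hηP : θ * (η * S) ≤ pMax p * (η * S) :=
    mul_le_mul_of_nonneg_right hθP (mul_nonneg hη.1 hS0)
  linarith

/-- The contraction of the expected gap in one step. -/
lemma sum_mul_gap_le (h : Assumptions f g) [Nonempty (Fin n)] [Nonempty (Idx N)]
    (hη : η ∈ Set.Icc (0 : ℝ) (1 / 4)) (hd : IsInexactDirection f g η d)
    (hx₀ : x₀ ∈ effDom (obj f g)) (hp : ∀ i, 0 < p i) (hp_sum : ∑ i, p i = 1)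
    (hloc : realVal (obj f g) x₀ ≤ optVal f g + omega (c1 f g η x₀ / pMin p))
    (hx : x ∈ levelSet f g x₀) :
    ∑ i, p i * (realVal (obj f g) (blockStep f d i x) - optVal f g) ≤
      (6 * c2 f g η d p x₀ + pMin p ^ 2 * (1 - theta f g d p x₀)) /
          (6 * c2 f g η d p x₀ + pMin p ^ 2) * (realVal (obj f g) x - optVal f g) := by
  have hA := sum_mul_decrease h hη hd hx₀ hp hp_sum hloc hx
  have hB := sum_mul_contraction h hη hd hx₀ hp hp_sum hloc hx
  have hq := pMin_pos hp
  have hc2 : 0 ≤ c2 f g η d p x₀ := abs_nonneg _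
  simp only [mul_sub, Finset.sum_sub_distrib]
  rw [← Finset.sum_mul, hp_sum, one_mul]
  rw [← mul_sub, div_mul_eq_mul_div, le_div_iff₀ (by positivity)]
  -- With weights 6c₂ and p_min² the two multiples of S cancel.
  have hA' := mul_le_mul_of_nonneg_left hA (by positivity : 0 ≤ 6 * c2 f g η d p x₀)
  have hB' := mul_le_mul_of_nonneg_left hB (sq_nonneg (pMin p))
  linarith

/-- If θ ≥ 1, then p_i ≥ 1 + λ_i(x⁰) for each i; since p_i ≤ 1, every λ_i(x⁰) vanishes and every p_i
is 1. For n > 1 the probabilities then sum to more than 1. Otherwise all d_i(x⁰) are zero, and the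
comparison with the minimizer shows F(x⁰) ≤ F*. -/
lemma theta_lt_one (h : Assumptions f g) [Nonempty (Fin n)]
    (hd : IsInexactDirection f g η d)
    (hx₀ : x₀ ∈ effDom (obj f g)) (hp : ∀ i, 0 < p i) (hp_sum : ∑ i, p i = 1)
    (hcase : 1 < n ∨ ∃ y, obj f g y < obj f g x₀) : theta f g d p x₀ < 1 := by
  by_contra hcon
  have hθ : ∀ i, 1 + lam f d i x₀ ≤ p i := fun i => by
    have h1 := (not_lt.1 hcon).trans (theta_le (f := f) (g := g) (d := d) (x₀ := x₀) hp
      (le_refl (obj f g x₀)) i)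
    rwa [one_le_div (by linarith [lam_nonneg f d i x₀])] at h1
  have hp1 : ∀ i, p i ≤ 1 := fun i => by
    rw [← hp_sum]
    exact Finset.single_le_sum (fun j _ => (hp j).le) (Finset.mem_univ i)
  have hlam : ∀ i, lam f d i x₀ = 0 := fun i =>
    le_antisymm (by linarith [hθ i, hp1 i]) (lam_nonneg f d i x₀)
  rcases hcase with hn | ⟨y, hy⟩
  · have h1 : (n : ℝ) ≤ ∑ i, p i := by
      calc (n : ℝ) = ∑ _i : Fin n, (1 : ℝ) := by simp
        _ ≤ _ := Finset.sum_le_sum fun i _ => by linarith [hθ i, hlam i]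
    rw [hp_sum] at h1
    have : (1 : ℝ) < n := by exact_mod_cast hn
    linarith
  · obtain ⟨z, hz, -⟩ := h.unique_min
    have hpred := obj_sub_optVal_ge_predChange h hd hx₀ hz
    have hzero : ∀ i, predChange f g d i x₀ = 0 := fun i => by
      have hd0 : d i x₀ = 0 := by
        by_contra hne
        exact (wNorm_pos (posDef_hessBlock (h.posDef x₀ hx₀) i) hne).ne' (hlam i)
      simp [predChange, hd0]
    simp only [hzero, hlam, Finset.sum_const_zero, zero_mul, mul_zero, ne_eq, OfNat.ofNat_ne_zero,
      not_false_eq_true, zero_pow, optVal_eq hz] at hpred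
    have hle : realVal (obj f g) x₀ ≤ realVal (obj f g) z := by linarith
    have := obj_le_of_realVal_le h (mem_effDom_of_le hx₀ (hz x₀)) hx₀ hle
    exact absurd ((this.trans (hz y)).trans_lt hy) (lt_irrefl _)

end OneStep

/-! ### Averaging over independent draws. -/

section RandomIterates

variable {Ω : Type*} [MeasurableSpace Ω] {μ : Measure Ω} {n : ℕ}
  {I : ℕ → Ω → Fin n}

/-- The draws before time `k`. -/
def history (I : ℕ → Ω → Fin n) (k : ℕ) (ω : Ω) : Finset.range k → Fin n := fun j => I j ω

lemma measurable_history (hI : ∀ k, Measurable (I k)) (k : ℕ) : Measurable (history I k) :=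
  measurable_pi_lambda _ fun j => hI j

lemma integrable_comp_history [IsProbabilityMeasure μ] (hI : ∀ k, Measurable (I k)) (k : ℕ)
    (ψ : (Finset.range k → Fin n) → ℝ) : Integrable (fun ω => ψ (history I k ω)) μ := by
  have hm := measurable_history hI k
  have := Measure.isProbabilityMeasure_map (μ := μ) hm.aemeasurable
  exact (Integrable.of_finite (f := ψ) (μ := μ.map (history I k))).comp_measurable hm

/-- The draw k and the draws before k use disjoint sets of indices of an independent family. -/
lemma indepFun_history (hI : ∀ k, Measurable (I k)) (hind : iIndepFun I μ) (k : ℕ) :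
    IndepFun (I k) (history I k) μ := by
  have h := hind.indepFun_finset {k} (Finset.range k) (by simp) hI
  exact h.comp (φ := fun t : ({k} : Finset ℕ) → Fin n => t ⟨k, Finset.mem_singleton_self k⟩)
    (ψ := id) (measurable_pi_apply _) measurable_id

/-- Conditioning on the history, a draw is averaged out with its law. -/
lemma integral_draw_history [IsProbabilityMeasure μ] (hI : ∀ k, Measurable (I k)) (hind : iIndepFun I μ) {p : Fin n → ℝ}
    (hp : ∀ i, 0 ≤ p i) (hlaw : ∀ k i, μ {ω | I k ω = i} = ENNReal.ofReal (p i)) (k : ℕ)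
    (φ : Fin n → (Finset.range k → Fin n) → ℝ) :
    ∫ ω, φ (I k ω) (history I k ω) ∂μ = ∫ ω, ∑ i, p i * φ i (history I k ω) ∂μ := by
  have hm := measurable_history hI k
  -- Splitting according to the drawn index gives products of an indicator of the draw and a
  -- function of the history; each expectation factors by independence.
  have hsplit : ∀ ω, φ (I k ω) (history I k ω) =
      ∑ i, (if I k ω = i then (1 : ℝ) else 0) * φ i (history I k ω) := fun ω => by simp
  have hmeas : ∀ i, Measurable fun a : Fin n => if a = i then (1 : ℝ) else 0 := fun i =>
    measurable_of_finite _
  have hind' : ∀ i, IndepFun (fun ω => if I k ω = i then (1 : ℝ) else 0)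
      (fun ω => φ i (history I k ω)) μ := fun i =>
    (indepFun_history hI hind k).comp (hmeas i) (measurable_of_finite (φ i))
  have hint1 : ∀ i, Integrable (fun ω => if I k ω = i then (1 : ℝ) else 0) μ := fun i => by
    have := Measure.isProbabilityMeasure_map (μ := μ) (hI k).aemeasurable
    exact (Integrable.of_finite (f := fun a : Fin n => if a = i then (1 : ℝ) else 0)
      (μ := μ.map (I k))).comp_measurable (hI k)
  have hint2 : ∀ i, Integrable (fun ω => φ i (history I k ω)) μ := fun i =>
    integrable_comp_history hI k (φ i)
  have hval : ∀ i, ∫ ω, (if I k ω = i then (1 : ℝ) else 0) ∂μ = p i := fun i => by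
    have hs : MeasurableSet {ω | I k ω = i} := hI k (measurableSet_singleton i)
    have : (fun ω => if I k ω = i then (1 : ℝ) else 0) = {ω | I k ω = i}.indicator 1 := by
      ext ω
      simp [Set.indicator]
    rw [this, integral_indicator_one hs, Measure.real, hlaw, ENNReal.toReal_ofReal (hp i)]
  simp only [hsplit]
  have hint3 : ∀ i, Integrable
      (fun ω => (if I k ω = i then (1 : ℝ) else 0) * φ i (history I k ω)) μ := fun i =>
    (hind' i).integrable_mul (hint1 i) (hint2 i)
  rw [integral_finsetSum _ fun i _ => hint3 i,
    integral_finsetSum _ fun i _ => (hint2 i).const_mul (p i)]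
  refine Finset.sum_congr rfl fun i _ => ?_
  rw [integral_const_mul, ← hval i]
  exact (hind' i).integral_mul_eq_mul_integral (hint1 i).aestronglyMeasurable
    (hint2 i).aestronglyMeasurable

variable {N : Fin n → ℕ} {f : Space N → EReal} {g : ∀ i, Block N i → EReal}
  {η : ℝ} {d : ∀ i, Space N → Block N i} {p : Fin n → ℝ} {x₀ : Space N}
  {X : ℕ → Ω → Space N}

lemma IsGenerated.succ_eq (hX : IsGenerated μ f d p x₀ I X) (k : ℕ) (ω : Ω) :
    X (k + 1) ω = blockStep f d (I k ω) (X k ω) := by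
  refine block_ext fun j => ?_
  by_cases hj : j = I k ω
  · subst hj
    rw [hX.update_self]
    simp [blockStep]
  · rw [hX.update_other k ω j hj]
    simp [blockStep, block_embed_of_ne hj]

/-- An iterate depends on finitely many draws from a finite set, so it takes finitely many values.
Integrability follows without any measurability of the directions. -/
lemma IsGenerated.exists_eq_history (hX : IsGenerated μ f d p x₀ I X) (k : ℕ) :
    ∃ Y : (Finset.range k → Fin n) → Space N, ∀ ω, X k ω = Y (history I k ω) := by
  induction k with
  | zero => exact ⟨fun _ => x₀, hX.init⟩
  | succ k ih =>
    obtain ⟨Y, hY⟩ := ih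
    refine ⟨fun t => blockStep f d (t ⟨k, by simp⟩)
      (Y fun j => t ⟨j, Finset.mem_range.2 ((Finset.mem_range.1 j.2).trans k.lt_succ_self)⟩),
      fun ω => ?_⟩
    rw [hX.succ_eq, hY]
    rfl

end RandomIterates

end RBPDN

/-! ### Iterating the one-step contraction. -/

theorem mainTheorem3 {n : ℕ} {N : Fin n → ℕ} (hN : ∀ i, 0 < N i)
    (f : Space N → EReal) (g : ∀ i, Block N i → EReal) (hfg : Assumptions f g)
    (x₀ : Space N) (hx₀ : x₀ ∈ effDom (obj f g))
    (η : ℝ) (hη : η ∈ Set.Icc (0 : ℝ) (1 / 4))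
    (p : Fin n → ℝ) (hp : ∀ i, 0 < p i) (hp_sum : ∑ i, p i = 1)
    (d : ∀ i, Space N → Block N i) (hd : IsInexactDirection f g η d)
    {Ω : Type*} [MeasurableSpace Ω] (μ : Measure Ω) [IsProbabilityMeasure μ]
    (I : ℕ → Ω → Fin n) (X : ℕ → Ω → Space N) (hX : IsGenerated μ f d p x₀ I X)
    (hloc : realVal (obj f g) x₀ ≤ optVal f g + omega (c1 f g η x₀ / pMin p)) :
    0 < theta f g d p x₀ ∧
    (1 < n ∨ (∃ y, obj f g y < obj f g x₀) → theta f g d p x₀ < 1) ∧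
    ∀ k : ℕ,
      (∀ ω, X k ω ∈ effDom (obj f g)) ∧
      Integrable (fun ω => realVal (obj f g) (X k ω) - optVal f g) μ ∧
      ∫ ω, (realVal (obj f g) (X k ω) - optVal f g) ∂μ ≤
        ((6 * c2 f g η d p x₀ + pMin p ^ 2 * (1 - theta f g d p x₀)) /
          (6 * c2 f g η d p x₀ + pMin p ^ 2)) ^ k * (realVal (obj f g) x₀ - optVal f g) := by
  have hne : Nonempty (Fin n) := by
    by_contra hcon
    rw [not_nonempty_iff] at hcon
    simp at hp_sum
  have hneIdx : Nonempty (Idx N) := hne.elim fun i => ⟨⟨i, ⟨0, hN i⟩⟩⟩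
  -- Monotonicity holds for every outcome, so the one-step estimates apply pointwise at each
  -- iterate.
  have hmem : ∀ k ω, X k ω ∈ levelSet f g x₀ := by
    intro k ω
    induction k with
    | zero => rw [hX.init]; exact le_refl (obj f g x₀)
    | succ k ih =>
      have hxd := mem_effDom_of_mem_levelSet hx₀ ih
      rw [hX.succ_eq]
      exact (obj_le_of_realVal_le hfg hxd (blockStep_spec hfg hd hxd _).1
        (blockStep_le hfg hη hd hxd _)).trans ih
  have hint : ∀ k, Integrable (fun ω => realVal (obj f g) (X k ω) - optVal f g) μ := by
    intro k
    obtain ⟨Y, hY⟩ := hX.exists_eq_history k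
    simp only [hY]
    exact integrable_comp_history hX.measurable k fun t => realVal (obj f g) (Y t) - optVal f g
  have hθ1 : theta f g d p x₀ ≤ 1 := by
    have i := hne.some
    have hl := lam_nonneg f d i x₀
    refine ((theta_le hp (le_refl (obj f g x₀)) i).trans (div_le_self (hp i).le
      (by linarith))).trans ?_
    rw [← hp_sum]
    exact Finset.single_le_sum (fun j _ => (hp j).le) (Finset.mem_univ i)
  -- Nonnegativity of the factor, from θ ≤ 1, allows the induction hypothesis to be multiplied by
  -- it.
  have hrate : 0 ≤ (6 * c2 f g η d p x₀ + pMin p ^ 2 * (1 - theta f g d p x₀)) /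
      (6 * c2 f g η d p x₀ + pMin p ^ 2) := by
    have hc2 : 0 ≤ c2 f g η d p x₀ := abs_nonneg _
    have := sub_nonneg.2 hθ1
    positivity
  refine ⟨theta_pos hfg hη hd hx₀ hp, theta_lt_one hfg hd hx₀ hp hp_sum, fun k =>
    ⟨fun ω => mem_effDom_of_mem_levelSet hx₀ (hmem k ω), hint k, ?_⟩⟩
  induction k with
  | zero => simp [hX.init]
  | succ k ih =>
    obtain ⟨Y, hY⟩ := hX.exists_eq_history k
    -- The k-th iterate is a function of the history, so the draw at step k is replaced by its
    -- average over the law p.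
    have hdraw := integral_draw_history hX.measurable hX.indep (fun i => (hp i).le) hX.law k
      fun i t => realVal (obj f g) (blockStep f d i (Y t)) - optVal f g
    simp only [← hY, ← hX.succ_eq] at hdraw
    rw [hdraw, pow_succ', mul_assoc]
    refine le_trans ?_ (mul_le_mul_of_nonneg_left ih hrate)
    rw [← integral_const_mul]
    refine integral_mono ?_ ((hint k).const_mul _) fun ω =>
      sum_mul_gap_le hfg hη hd hx₀ hp hp_sum hloc (hmem k ω)
    simp only [hY]
    exact integrable_comp_history hX.measurable k fun t =>
      ∑ i, p i * (realVal (obj f g) (blockStep f d i (Y t)) - optVal f g)
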